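/- For positive integers $k,\ell$, let the Ramsey number $R(k,\ell)$ be the smallest positive integer $n$ such that every graph on $n$ vertices contains a clique of size $k$ or an independent set of size $\ell$. There is an absolute constant $c>0$ such that for every integer $k\ge 3$, \[R(k+1,k+1)\le e^{-c(\log k)^2}\binom{2k}{k}.\] -/

import Mathlib

/-- Every graph on `n` vertices contains a clique of size `k` or an independent set of size `l`. -/
def RamseyProperty (k l n : ℕ) : Prop :=
  ∀ G : SimpleGraph (Fin n),
    (∃ s : Finset (Fin n), G.IsNClique k s) ∨ (∃ s : Finset (Fin n), G.IsNIndepSet l s)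

/-- Every sufficiently large vertex set contains a clique of size `k` or an independent set of
size `l`. -/
theorem exists_clique_or_indepSet_of_large (k l : ℕ) :
    ∃ N : ℕ, ∀ (n : ℕ) (G : SimpleGraph (Fin n)) (S : Finset (Fin n)), N ≤ S.card →
      (∃ s ⊆ S, G.IsNClique k s) ∨ (∃ s ⊆ S, G.IsNIndepSet l s) := by
  classical
  induction k generalizing l with
  | zero => exact ⟨0, fun n G S _ => Or.inl ⟨∅, by simp, by simp [SimpleGraph.isNClique_iff]⟩⟩
  | succ k ihk =>
    induction l with
    | zero => exact ⟨0, fun n G S _ => Or.inr ⟨∅, by simp, by simp [SimpleGraph.isNIndepSet_iff]⟩⟩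
    | succ l ihl =>
      obtain ⟨a, ha⟩ := ihk (l + 1)
      obtain ⟨b, hb⟩ := ihl
      refine ⟨a + b + 1, fun n G S hS => ?_⟩
      obtain ⟨v, hv⟩ : S.Nonempty := Finset.card_pos.mp (by omega)
      have hsplit := Finset.card_filter_add_card_filter_not (s := S.erase v) (fun w => G.Adj v w)
      rw [Finset.card_erase_of_mem hv] at hsplit
      by_cases h : a ≤ ((S.erase v).filter (fun w => G.Adj v w)).card
      · rcases ha n G _ h with ⟨s, hs, hc⟩ | ⟨s, hs, hc⟩
        · refine Or.inl ⟨insert v s, ?_, hc.insert ?_⟩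
          · intro x hx
            rcases Finset.mem_insert.mp hx with rfl | hx
            · exact hv
            · exact Finset.mem_of_mem_erase (Finset.mem_filter.mp (hs hx)).1
          · intro x hx
            exact (Finset.mem_filter.mp (hs hx)).2
        · exact Or.inr ⟨s, fun x hx =>
            Finset.mem_of_mem_erase (Finset.mem_filter.mp (hs hx)).1, hc⟩
      · rcases hb n G ((S.erase v).filter (fun w => ¬ G.Adj v w)) (by omega) with
          ⟨s, hs, hc⟩ | ⟨s, hs, hc⟩
        · exact Or.inl ⟨s, fun x hx =>
            Finset.mem_of_mem_erase (Finset.mem_filter.mp (hs hx)).1, hc⟩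
        · refine Or.inr ⟨insert v s, ?_, ?_⟩
          · intro x hx
            rcases Finset.mem_insert.mp hx with rfl | hx
            · exact hv
            · exact Finset.mem_of_mem_erase (Finset.mem_filter.mp (hs hx)).1
          · rw [← SimpleGraph.isNClique_compl] at hc ⊢
            refine hc.insert fun x hx => ?_
            have hx' := Finset.mem_filter.mp (hs hx)
            rw [SimpleGraph.compl_adj]
            exact ⟨(Finset.ne_of_mem_erase hx'.1).symm, hx'.2⟩

/-- Ramsey numbers exist. -/
theorem exists_ramseyProperty (k l : ℕ) : ∃ n : ℕ, 0 < n ∧ RamseyProperty k l n := by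
  obtain ⟨N, hN⟩ := exists_clique_or_indepSet_of_large k l
  refine ⟨N + 1, Nat.succ_pos N, fun G => ?_⟩
  rcases hN (N + 1) G Finset.univ (by simp) with ⟨s, -, hs⟩ | ⟨s, -, hs⟩
  · exact Or.inl ⟨s, hs⟩
  · exact Or.inr ⟨s, hs⟩

open Classical in
/-- The Ramsey number `R(k, l)`: the smallest positive integer `n` such that every graph on `n`
vertices contains a clique of size `k` or an independent set of size `l`. -/
noncomputable def ramseyNumber (k l : ℕ) : ℕ :=
  Nat.find (exists_ramseyProperty k l)

/-! For large `k` an exponential saving over Erdős–Szekeres is available: for some `η > 0`, every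
two-colouring on at least `4 ^ k * exp (-(η * k))` points contains a monochromatic clique of size
`k` (`exists_forces_of_four_pow_mul_exp_le`). Since the central binomial coefficient is at least `4
^ k / (2 k)`, this is far stronger than the claim. For the finitely many remaining `k ≥ 3` any
saving suffices after shrinking `c`; subtracting one from the binomial bound is enough, and that
saving is inherited from `R(3, 4) ≤ 9`.

For the exponential saving, run Erdős–Szekeres steps while some vertex has colour density at least
`1/2 + ε`; each such step gains a factor `1 + 2ε`. If the steps stop early, both colours are nearly
regular, and `exists_book` gives a monochromatic clique `T` of size `t` joined in its colour to a
set `S` of relative size about `2 ^ (-t)`. The clique still sought inside `S` is then smaller in one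
colour only, and an off-diagonal binomial coefficient is smaller than the trivial bound by an
exponential factor, which beats the losses.

The book is built from `X` and one reservoir `Y i` per colour. The codegree deviations in the
reservoirs are Gram kernels, so they cannot be too negative on most pairs unless compensated by
large positive values. Hence (`exists_pivot`) some `x` has many partners in `X` that nearly keep
both densities, with one density boosted by an amount matched to the loss in `X`. A small boost
leads to adding `x` to a spine; a large one is taken as a density increment. `bookPotential` pays
for the increments. -/

/-! ### Gram kernels. -/

/-- A kernel is Gram if it is the inner product of a family of real vectors. -/
def IsGramKernel {V : Type} (K : V → V → ℝ) : Prop :=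
  ∃ (ι : Type) (_ : Fintype ι) (f : V → ι → ℝ), ∀ x y, K x y = ∑ v, f x v * f y v

namespace IsGramKernel

variable {V : Type} {K L : V → V → ℝ}

theorem one : IsGramKernel (fun _ _ : V => (1 : ℝ)) :=
  ⟨Unit, inferInstance, fun _ _ => 1, by simp⟩

theorem mul (hK : IsGramKernel K) (hL : IsGramKernel L) :
    IsGramKernel (fun x y => K x y * L x y) := by
  obtain ⟨ι, _, f, hf⟩ := hK
  obtain ⟨κ, _, g, hg⟩ := hL
  refine ⟨ι × κ, inferInstance, fun x v => f x v.1 * g x v.2, fun x y => ?_⟩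
  simp only [hf, hg]
  rw [Finset.sum_mul_sum, Fintype.sum_prod_type]
  exact Finset.sum_congr rfl fun i _ => Finset.sum_congr rfl fun j _ => by ring

theorem pow (hK : IsGramKernel K) (n : ℕ) : IsGramKernel (fun x y => K x y ^ n) := by
  induction n with
  | zero => simpa using one
  | succ n ih => simpa only [pow_succ] using ih.mul hK

theorem const_mul (hK : IsGramKernel K) {c : ℝ} (hc : 0 ≤ c) :
    IsGramKernel (fun x y => c * K x y) := by
  obtain ⟨ι, _, f, hf⟩ := hK
  refine ⟨ι, inferInstance, fun x v => √c * f x v, fun x y => ?_⟩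
  simp only [hf]
  rw [Finset.mul_sum]
  refine Finset.sum_congr rfl fun i _ => ?_
  have := Real.mul_self_sqrt hc
  linear_combination -(f x i * f y i) * this

theorem sum_nonneg (hK : IsGramKernel K) (s : Finset V) :
    0 ≤ ∑ z ∈ s ×ˢ s, K z.1 z.2 := by
  obtain ⟨ι, _, f, hf⟩ := hK
  have : ∑ z ∈ s ×ˢ s, K z.1 z.2 = ∑ v, (∑ x ∈ s, f x v) * (∑ y ∈ s, f y v) := by
    rw [Finset.sum_congr rfl fun z _ => hf z.1 z.2, Finset.sum_comm]
    refine Finset.sum_congr rfl fun v _ => ?_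
    rw [Finset.sum_mul_sum, Finset.sum_product]
  rw [this]
  exact Finset.sum_nonneg fun v _ => mul_self_nonneg _

end IsGramKernel

/-! ### The test function built from `cosh √z`. -/

/-- The entire function `z ↦ cosh √z` on the real line. -/
noncomputable def coshSqrt (z : ℝ) : ℝ :=
  if 0 ≤ z then Real.cosh (√z) else Real.cos (√(-z))

theorem hasSum_coshSqrt (z : ℝ) :
    HasSum (fun n : ℕ => z ^ n / ((2 * n).factorial : ℝ)) (coshSqrt z) := by
  unfold coshSqrt
  split_ifs with h
  · have := Real.hasSum_cosh (√z)
    simpa only [pow_mul, Real.sq_sqrt h] using this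
  · have := Real.hasSum_cos (√(-z))
    have h' : 0 ≤ -z := by linarith
    have e : ∀ n : ℕ, (-1 : ℝ) ^ n * √(-z) ^ (2 * n) = z ^ n := fun n => by
      rw [pow_mul, Real.sq_sqrt h', ← mul_pow]; ring
    simpa only [e] using this

/-- The Taylor coefficients `1 / (2n)!` are nonnegative, and products of Gram kernels are Gram
(Schur), so each term of the expansion has nonnegative sum over `s ×ˢ s`. -/
theorem IsGramKernel.sum_mul_coshSqrt_nonneg {V : Type} {K L : V → V → ℝ}
    (hK : IsGramKernel K) (hL : IsGramKernel L) (s : Finset V) :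
    0 ≤ ∑ z ∈ s ×ˢ s, K z.1 z.2 * (2 + coshSqrt (L z.1 z.2)) := by
  have h1 := hK.sum_nonneg s
  have h2 : 0 ≤ ∑ z ∈ s ×ˢ s, K z.1 z.2 * coshSqrt (L z.1 z.2) := by
    have := hasSum_sum (s := s ×ˢ s) fun z _ => (hasSum_coshSqrt (L z.1 z.2)).mul_left (K z.1 z.2)
    refine this.nonneg fun n => ?_
    have h3 := (hK.mul (hL.pow n)).sum_nonneg s
    have : ∑ z ∈ s ×ˢ s, K z.1 z.2 * (L z.1 z.2 ^ n / ((2 * n).factorial : ℝ))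
        = (∑ z ∈ s ×ˢ s, K z.1 z.2 * L z.1 z.2 ^ n) / ((2 * n).factorial : ℝ) := by
      rw [Finset.sum_div]
      exact Finset.sum_congr rfl fun z _ => by ring
    rw [this]
    positivity
  have : ∑ z ∈ s ×ˢ s, K z.1 z.2 * (2 + coshSqrt (L z.1 z.2))
      = 2 * ∑ z ∈ s ×ˢ s, K z.1 z.2 + ∑ z ∈ s ×ˢ s, K z.1 z.2 * coshSqrt (L z.1 z.2) := by
    rw [Finset.mul_sum, ← Finset.sum_add_distrib]
    exact Finset.sum_congr rfl fun z _ => by ring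
  linarith

theorem coshSqrt_mem_of_neg {z : ℝ} (hz : z < 0) : -1 ≤ coshSqrt z ∧ coshSqrt z ≤ 1 := by
  rw [coshSqrt, if_neg (not_le.mpr hz)]
  exact ⟨Real.neg_one_le_cos _, Real.cos_le_one _⟩

theorem one_add_half_le_coshSqrt {z : ℝ} (hz : 0 ≤ z) : 1 + z / 2 ≤ coshSqrt z := by
  have h := hasSum_coshSqrt z
  have := h.summable.sum_le_tsum (Finset.range 2) (fun n _ => by positivity)
  rw [h.tsum_eq] at this
  simpa [Finset.sum_range_succ, Nat.factorial] using this

theorem one_le_coshSqrt {z : ℝ} (hz : 0 ≤ z) : 1 ≤ coshSqrt z := by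
  linarith [one_add_half_le_coshSqrt hz]

theorem coshSqrt_le_exp {z r : ℝ} (hr : 0 ≤ r) (hz : z ≤ r ^ 2) : coshSqrt z ≤ Real.exp r := by
  rcases lt_or_ge z 0 with h | h
  · exact (coshSqrt_mem_of_neg h).2.trans (Real.one_le_exp hr)
  · rw [coshSqrt, if_pos h]
    have h1 : √z ≤ r := Real.sqrt_le_iff.mpr ⟨hr, hz⟩
    have h2 : Real.cosh (√z) ≤ Real.exp (√z) := by
      rw [Real.cosh_eq]
      have := Real.exp_le_exp.mpr (show -√z ≤ √z by linarith [Real.sqrt_nonneg z])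
      linarith
    exact h2.trans (Real.exp_le_exp.mpr h1)

theorem two_add_coshSqrt_nonneg (z : ℝ) : 1 ≤ 2 + coshSqrt z := by
  rcases lt_or_ge z 0 with h | h
  · linarith [(coshSqrt_mem_of_neg h).1]
  · linarith [one_le_coshSqrt h]

/-- The test function is very negative as soon as one coordinate is. -/
theorem coshSqrt_test_le_neg {x y : ℝ} (hx : x < -6) :
    x * (2 + coshSqrt y) + y * (2 + coshSqrt x) ≤ -6 := by
  have hx' := coshSqrt_mem_of_neg (show x < 0 by linarith)
  have hy' := two_add_coshSqrt_nonneg y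
  rcases lt_or_ge y 0 with h | h
  · nlinarith [two_add_coshSqrt_nonneg x]
  -- The linear growth `y / 2`, multiplied by `x < -6`, contributes at most `-3 * y`; this cancels
  -- `y * (2 + coshSqrt x) ≤ 3 * y` and explains the cutoff `-6`.
  · have := one_add_half_le_coshSqrt h
    nlinarith

theorem coshSqrt_test_le_exp {x y r : ℝ} (hr : 0 ≤ r) (hx : x ≤ r ^ 2) (hy : y ≤ r ^ 2) :
    x * (2 + coshSqrt y) + y * (2 + coshSqrt x) ≤ 12 * Real.exp (2 * r) := by
  have key : ∀ u v : ℝ, u ≤ r ^ 2 → v ≤ r ^ 2 →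
      u * (2 + coshSqrt v) ≤ 6 * Real.exp (2 * r) := by
    intro u v hu hv
    have h1 := two_add_coshSqrt_nonneg v
    have h2 := coshSqrt_le_exp hr hv
    have h3 := Real.quadratic_le_exp_of_nonneg hr
    have h4 := Real.one_le_exp hr
    have h5 : Real.exp (2 * r) = Real.exp r * Real.exp r := by rw [← Real.exp_add]; ring_nf
    rw [h5]
    calc u * (2 + coshSqrt v) ≤ r ^ 2 * (2 + coshSqrt v) := by
          exact mul_le_mul_of_nonneg_right hu (by linarith)
      _ ≤ (2 * Real.exp r) * (3 * Real.exp r) := by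
          apply mul_le_mul <;> nlinarith
      _ = _ := by ring
  have := key x y hx hy
  have := key y x hy hx
  linarith

/-! ### Correlated pairs for two Gram kernels. -/

open Classical in
/-- Some threshold `j` is exceeded by the larger of two Gram kernels, with both kernels bounded
below, on a proportion of pairs that is only exponentially small in `j`. -/
theorem IsGramKernel.exists_many_pairs {V : Type} {K : Bool → V → V → ℝ}
    (hK : ∀ i, IsGramKernel (K i)) {s : Finset V} (hs : s.Nonempty) :
    ∃ j : ℕ, (s.card : ℝ) ^ 2 * Real.exp (-(3 * j)) / 100 ≤
      ((s ×ˢ s).filter fun z => (∀ i, -6 ≤ K i z.1 z.2) ∧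
        ∃ i, (j : ℝ) ^ 2 - 6 ≤ K i z.1 z.2).card := by
  by_contra! hcon
  set F : V × V → ℝ := fun z => K true z.1 z.2 * (2 + coshSqrt (K false z.1 z.2))
    + K false z.1 z.2 * (2 + coshSqrt (K true z.1 z.2)) with hF
  have hF0 : 0 ≤ ∑ z ∈ s ×ˢ s, F z := by
    rw [Finset.sum_add_distrib]
    exact add_nonneg ((hK true).sum_mul_coshSqrt_nonneg (hK false) s)
      ((hK false).sum_mul_coshSqrt_nonneg (hK true) s)
  set N : ℝ := (s.card : ℝ) ^ 2 with hN
  have hNpos : 0 < N := by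
    have : 0 < s.card := hs.card_pos
    positivity
  set E := (s ×ˢ s).filter fun z => ∀ i, -6 ≤ K i z.1 z.2 with hE
  set B := (s ×ˢ s).filter fun z => ¬ ∀ i, -6 ≤ K i z.1 z.2 with hB
  have hEB : ((E.card : ℝ) + B.card) = N := by
    have := Finset.card_filter_add_card_filter_not (s := s ×ˢ s)
      (fun z => ∀ i, -6 ≤ K i z.1 z.2)
    rw [Finset.card_product] at this
    have h2 : E.card + B.card = s.card * s.card := this
    rw [hN, sq, ← Nat.cast_add, h2, Nat.cast_mul]
  have hEcard : (E.card : ℝ) < N / 100 := by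
    -- At `j = 0` the threshold `j ^ 2 - 6` is the lower cutoff itself, so the second condition is
    -- automatic on `E`.
    have h0 := hcon 0
    have h2 : N * Real.exp (-(3 * ((0 : ℕ) : ℝ))) / 100 = N / 100 := by simp
    refine lt_of_le_of_lt (Nat.cast_le.mpr (Finset.card_le_card ?_)) (h0.trans_eq h2)
    intro z hz
    rw [hE, Finset.mem_filter] at hz
    rw [Finset.mem_filter]
    exact ⟨hz.1, hz.2, true, by simpa using hz.2 true⟩
  have hBsum : ∑ z ∈ B, F z ≤ -6 * B.card := by
    have : ∑ z ∈ B, F z ≤ ∑ z ∈ B, (-6 : ℝ) := by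
      refine Finset.sum_le_sum fun z hz => ?_
      have hz' := (Finset.mem_filter.mp hz).2
      push Not at hz'
      obtain ⟨i, hi⟩ := hz'
      cases i
      · have := coshSqrt_test_le_neg (y := K true z.1 z.2) hi
        simp only [hF]; linarith
      · exact coshSqrt_test_le_neg hi
    simpa [mul_comm] using this
  -- Slice `E` by the largest admissible threshold. On slice `j` the test function is at most `12 *
  -- exp (2 * (j + 1))`, while the slice has proportion at most `exp (-(3 * j)) / 100`, so the
  -- contributions decay geometrically.
  set r : V × V → ℕ := fun z => ⌊√(max (K true z.1 z.2) (K false z.1 z.2) + 6)⌋₊ with hr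
  set J := E.sup r + 1 with hJ
  have hmap : ∀ z ∈ E, r z ∈ Finset.range J := fun z hz =>
    Finset.mem_range.mpr (Nat.lt_succ_of_le (Finset.le_sup hz))
  have hEsum : ∑ z ∈ E, F z ≤ ∑ j ∈ Finset.range J, (N / 100) * (12 * Real.exp 2 * Real.exp (-1) ^ j) := by
    rw [← Finset.sum_fiberwise_of_maps_to hmap]
    refine Finset.sum_le_sum fun j _ => ?_
    have hb : ∀ z ∈ E.filter (fun z => r z = j), F z ≤ 12 * Real.exp (2 * (j + 1)) := by
      intro z hz
      obtain ⟨hzE, hzj⟩ := Finset.mem_filter.mp hz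
      have hz6 := (Finset.mem_filter.mp hzE).2
      have h1 := Nat.lt_floor_add_one (√(max (K true z.1 z.2) (K false z.1 z.2) + 6))
      have h2 : ⌊√(max (K true z.1 z.2) (K false z.1 z.2) + 6)⌋₊ = j := hzj
      rw [h2] at h1
      have h3 : 0 ≤ max (K true z.1 z.2) (K false z.1 z.2) + 6 := by
        linarith [le_max_left (K true z.1 z.2) (K false z.1 z.2), hz6 true]
      have h4 : max (K true z.1 z.2) (K false z.1 z.2) + 6 < ((j : ℝ) + 1) ^ 2 :=
        (Real.sqrt_lt' (by positivity)).mp h1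
      exact coshSqrt_test_le_exp (by positivity)
        (by linarith [le_max_left (K true z.1 z.2) (K false z.1 z.2)])
        (by linarith [le_max_right (K true z.1 z.2) (K false z.1 z.2)])
    have hc : ((E.filter (fun z => r z = j)).card : ℝ) ≤ N * Real.exp (-(3 * j)) / 100 := by
      refine le_trans (Nat.cast_le.mpr (Finset.card_le_card ?_)) (hcon j).le
      intro z hz
      obtain ⟨hzE, hzj⟩ := Finset.mem_filter.mp hz
      obtain ⟨hzs, hz6⟩ := Finset.mem_filter.mp hzE
      refine Finset.mem_filter.mpr ⟨hzs, hz6, ?_⟩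
      have h2 : ⌊√(max (K true z.1 z.2) (K false z.1 z.2) + 6)⌋₊ = j := hzj
      have h3 : 0 ≤ max (K true z.1 z.2) (K false z.1 z.2) + 6 := by
        linarith [le_max_left (K true z.1 z.2) (K false z.1 z.2), hz6 true]
      have h1 := Nat.floor_le (Real.sqrt_nonneg (max (K true z.1 z.2) (K false z.1 z.2) + 6))
      rw [h2] at h1
      have h4 := (Real.le_sqrt (by positivity) h3).mp h1
      rcases le_total (K true z.1 z.2) (K false z.1 z.2) with h | h
      · exact ⟨false, by rw [max_eq_right h] at h4; linarith⟩
      · exact ⟨true, by rw [max_eq_left h] at h4; linarith⟩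
    calc ∑ z ∈ E.filter (fun z => r z = j), F z
        ≤ (E.filter (fun z => r z = j)).card • (12 * Real.exp (2 * (j + 1))) :=
          Finset.sum_le_card_nsmul _ _ _ hb
      _ ≤ (N * Real.exp (-(3 * j)) / 100) * (12 * Real.exp (2 * (j + 1))) := by
          rw [nsmul_eq_mul]
          exact mul_le_mul_of_nonneg_right hc (by positivity)
      _ = (N / 100) * (12 * (Real.exp (-(3 * j)) * Real.exp (2 * (j + 1)))) := by ring
      _ = (N / 100) * (12 * Real.exp 2 * Real.exp (-1) ^ j) := by
          rw [← Real.exp_add, ← Real.exp_nat_mul, mul_assoc 12, ← Real.exp_add]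
          ring_nf
  have he1 : Real.exp (-1) < 1 / 2 := by
    rw [Real.exp_neg, inv_lt_comm₀ (Real.exp_pos 1) (by norm_num)]
    linarith [Real.exp_one_gt_d9]
  have hgeo : ∑ j ∈ Finset.range J, Real.exp (-1) ^ j ≤ 2 := by
    have h0 : 0 ≤ Real.exp (-1) := (Real.exp_pos _).le
    calc ∑ j ∈ Finset.range J, Real.exp (-1) ^ j ≤ (1 - Real.exp (-1))⁻¹ := by
          have hs := summable_geometric_of_lt_one h0 (by linarith)
          rw [← tsum_geometric_of_lt_one h0 (by linarith)]
          exact hs.sum_le_tsum _ fun n _ => by positivity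
      _ ≤ 2 := by
          rw [inv_le_comm₀ (by linarith) (by norm_num)]
          linarith
  have he2 : Real.exp 2 ≤ 8 := by
    have : Real.exp 2 = Real.exp 1 * Real.exp 1 := by rw [← Real.exp_add]; norm_num
    rw [this]
    nlinarith [Real.exp_one_lt_d9, Real.exp_pos 1]
  rw [← Finset.mul_sum, ← Finset.mul_sum] at hEsum
  have hfin : 12 * Real.exp 2 * ∑ j ∈ Finset.range J, Real.exp (-1) ^ j ≤ 192 := by
    nlinarith [Real.exp_pos 2]
  have hsplit : ∑ z ∈ s ×ˢ s, F z = ∑ z ∈ E, F z + ∑ z ∈ B, F z :=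
    (Finset.sum_filter_add_sum_filter_not _ _ _).symm
  have : (N / 100) * (12 * Real.exp 2 * ∑ j ∈ Finset.range J, Real.exp (-1) ^ j) ≤ N / 100 * 192 :=
    mul_le_mul_of_nonneg_left hfin (by positivity)
  -- `B` contributes below `-6 * 0.99 * N` and `E` at most `1.92 * N`, contradicting `hF0`.
  linarith

open Classical in
/-- A vertex, a colour and a threshold with many partners. -/
theorem IsGramKernel.exists_rich_vertex {V : Type} {K : Bool → V → V → ℝ}
    (hK : ∀ i, IsGramKernel (K i)) {s : Finset V} (hs : s.Nonempty) :
    ∃ j : ℕ, ∃ i : Bool, ∃ x ∈ s, (s.card : ℝ) * Real.exp (-(3 * j)) / 200 ≤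
      (s.filter fun y => (∀ i, -6 ≤ K i x y) ∧ (j : ℝ) ^ 2 - 6 ≤ K i x y).card := by
  obtain ⟨j, hj⟩ := exists_many_pairs hK hs
  refine ⟨j, ?_⟩
  by_contra! hcon
  have hle : ((s ×ˢ s).filter fun z => (∀ i, -6 ≤ K i z.1 z.2) ∧
        ∃ i, (j : ℝ) ^ 2 - 6 ≤ K i z.1 z.2).card ≤ ∑ x ∈ s, ∑ i : Bool,
      (s.filter fun y => (∀ i, -6 ≤ K i x y) ∧ (j : ℝ) ^ 2 - 6 ≤ K i x y).card := by
    rw [Finset.card_filter, Finset.sum_product]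
    refine Finset.sum_le_sum fun x _ => ?_
    rw [← Finset.card_filter, Fintype.sum_bool]
    refine le_trans (Finset.card_le_card ?_) (Finset.card_union_le _ _)
    intro y hy
    simp only [Finset.mem_filter, Finset.mem_union, Bool.exists_bool] at hy ⊢
    tauto
  have hlt : ((∑ x ∈ s, ∑ i : Bool, (s.filter fun y => (∀ i, -6 ≤ K i x y) ∧
      (j : ℝ) ^ 2 - 6 ≤ K i x y).card : ℕ) : ℝ)
      < ∑ x ∈ s, ∑ i : Bool, (s.card : ℝ) * Real.exp (-(3 * j)) / 200 := by
    push_cast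
    exact Finset.sum_lt_sum_of_nonempty hs fun x hx =>
      Finset.sum_lt_sum_of_nonempty Finset.univ_nonempty fun i _ => hcon i x hx
  have : ((_ : ℕ) : ℝ) ≤ _ := Nat.cast_le.mpr hle
  have e : ∑ x ∈ s, ∑ i : Bool, (s.card : ℝ) * Real.exp (-(3 * j)) / 200
      = (s.card : ℝ) ^ 2 * Real.exp (-(3 * j)) / 100 := by
    simp only [Finset.sum_const, nsmul_eq_mul, Finset.card_univ, Fintype.card_bool]
    push_cast; ring
  linarith

/-! ### Codegrees and the choice of a pivot. -/

open Classical in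
/-- The neighbours of `x` in `S` in colour `i`. -/
noncomputable def colorNbrs {V : Type} (H : Bool → SimpleGraph V) (i : Bool) (x : V)
    (S : Finset V) : Finset V :=
  S.filter fun y => (H i).Adj x y

section

variable {V : Type} {H : Bool → SimpleGraph V} {i : Bool} {x y : V} {S : Finset V}

theorem mem_colorNbrs : y ∈ colorNbrs H i x S ↔ y ∈ S ∧ (H i).Adj x y := by
  simp [colorNbrs]

theorem colorNbrs_subset : colorNbrs H i x S ⊆ S := fun _ h => (mem_colorNbrs.mp h).1

theorem not_mem_colorNbrs_self : x ∉ colorNbrs H i x S := fun h =>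
  (H i).irrefl (mem_colorNbrs.mp h).2

/-- The normalised codegree deviation of `x` and `y` in `Y`. -/
noncomputable def codegKernel (H : Bool → SimpleGraph V) (i : Bool) (Y : Finset V)
    (x y : V) : ℝ := by
  classical exact ∑ v : Y,
    ((if (H i).Adj x v then ((colorNbrs H i x Y).card : ℝ)⁻¹ else 0) - (Y.card : ℝ)⁻¹) *
    ((if (H i).Adj y v then ((colorNbrs H i y Y).card : ℝ)⁻¹ else 0) - (Y.card : ℝ)⁻¹)

theorem isGramKernel_codegKernel (H : Bool → SimpleGraph V) (i : Bool) (Y : Finset V) :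
    IsGramKernel (codegKernel H i Y) := by
  classical
  exact ⟨Y, inferInstance,
    fun x v => (if (H i).Adj x v then ((colorNbrs H i x Y).card : ℝ)⁻¹ else 0) - (Y.card : ℝ)⁻¹,
    fun x y => by unfold codegKernel; congr⟩

theorem codegKernel_eq {Y : Finset V} (hx : (colorNbrs H i x Y).Nonempty)
    (hy : (colorNbrs H i y Y).Nonempty) :
    codegKernel H i Y x y = ((colorNbrs H i y (colorNbrs H i x Y)).card : ℝ) /
      ((colorNbrs H i x Y).card * (colorNbrs H i y Y).card) - (Y.card : ℝ)⁻¹ := by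
  classical
  have hx' : ((colorNbrs H i x Y).card : ℝ) ≠ 0 := by exact_mod_cast hx.card_pos.ne'
  have hy' : ((colorNbrs H i y Y).card : ℝ) ≠ 0 := by exact_mod_cast hy.card_pos.ne'
  have hY' : (Y.card : ℝ) ≠ 0 := by
    exact_mod_cast (hx.mono colorNbrs_subset).card_pos.ne'
  set a := ((colorNbrs H i x Y).card : ℝ) with ha
  set b := ((colorNbrs H i y Y).card : ℝ) with hb
  set n := (Y.card : ℝ) with hn
  have key : ∀ v ∈ Y, ((if (H i).Adj x v then a⁻¹ else 0) - n⁻¹) *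
      ((if (H i).Adj y v then b⁻¹ else 0) - n⁻¹)
      = (a * b)⁻¹ * (if (H i).Adj x v ∧ (H i).Adj y v then 1 else 0)
        - (a * n)⁻¹ * (if (H i).Adj x v then 1 else 0)
        - (b * n)⁻¹ * (if (H i).Adj y v then 1 else 0) + n⁻¹ * n⁻¹ := by
    intro v _
    by_cases h1 : (H i).Adj x v <;> by_cases h2 : (H i).Adj y v <;> simp [h1, h2] <;> ring
  have hsum : codegKernel H i Y x y = ∑ v ∈ Y, ((if (H i).Adj x v then a⁻¹ else 0) - n⁻¹) *
      ((if (H i).Adj y v then b⁻¹ else 0) - n⁻¹) := by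
    unfold codegKernel
    rw [← Finset.sum_coe_sort Y]
  rw [hsum, Finset.sum_congr rfl key, Finset.sum_add_distrib, Finset.sum_sub_distrib,
    Finset.sum_sub_distrib, ← Finset.mul_sum, ← Finset.mul_sum, ← Finset.mul_sum,
    Finset.sum_boole, Finset.sum_boole, Finset.sum_boole]
  have e1 : Y.filter (fun v => (H i).Adj x v ∧ (H i).Adj y v)
      = colorNbrs H i y (colorNbrs H i x Y) := by
    ext v; simp [mem_colorNbrs, and_assoc]
  have e2 : ((Y.filter (fun v => (H i).Adj x v)).card : ℝ) = a := by
    rw [ha]; unfold colorNbrs; congr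
  have e3 : ((Y.filter (fun v => (H i).Adj y v)).card : ℝ) = b := by
    rw [hb]; unfold colorNbrs; congr
  rw [e1, e2, e3, Finset.sum_const, nsmul_eq_mul, ← hn]
  field_simp
  ring

/-- The scaling `6 * (p * |Y| / α)` measures density change in units of `α / 6`: kernel value `-6`
means losing at most `α`, and `j ^ 2 - 6` means gaining `(j ^ 2 / 6 - 1) * α`. -/
theorem codeg_ge_of_codegKernel_ge {Y : Finset V} {p α μ : ℝ} (hp : 0 < p) (hα : 0 < α)
    (hY : Y.Nonempty) (hx : p * Y.card ≤ (colorNbrs H i x Y).card)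
    (hy : p * Y.card ≤ (colorNbrs H i y Y).card)
    (h : 6 * μ ≤ 6 * (p * Y.card / α) * codegKernel H i Y x y) :
    (p + μ * α) * (colorNbrs H i x Y).card ≤ (colorNbrs H i y (colorNbrs H i x Y)).card := by
  have hn : (0 : ℝ) < Y.card := by exact_mod_cast hY.card_pos
  have ha : (0 : ℝ) < (colorNbrs H i x Y).card := lt_of_lt_of_le (by positivity) hx
  have hb : (0 : ℝ) < (colorNbrs H i y Y).card := lt_of_lt_of_le (by positivity) hy
  rw [codegKernel_eq (Finset.card_pos.mp (by exact_mod_cast ha))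
    (Finset.card_pos.mp (by exact_mod_cast hb))] at h
  set a := ((colorNbrs H i x Y).card : ℝ)
  set b := ((colorNbrs H i y Y).card : ℝ)
  set n := (Y.card : ℝ)
  set d := ((colorNbrs H i y (colorNbrs H i x Y)).card : ℝ) with hd
  have hd0 : 0 ≤ d := Nat.cast_nonneg _
  rcases lt_or_ge (p + μ * α) 0 with hneg | hpos
  · nlinarith
  · have e : 6 * (p * n / α) * (d / (a * b) - n⁻¹) = 6 * ((p * n * d - p * a * b) / (α * a * b)) := by
      field_simp
    rw [e] at h
    have h1 : μ ≤ (p * n * d - p * a * b) / (α * a * b) := by linarith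
    rw [le_div_iff₀ (by positivity)] at h1
    have h2 : (p + μ * α) * a * b ≤ p * n * d := by nlinarith
    have h3 : (p + μ * α) * a * (p * n) ≤ (p + μ * α) * a * b :=
      mul_le_mul_of_nonneg_left hy (by positivity)
    have h4 : (p * n) * ((p + μ * α) * a) ≤ (p * n) * d := by linarith
    exact le_of_mul_le_mul_left h4 (by positivity)

/-- One step of the book algorithm. -/
theorem exists_pivot {X : Finset V} (hX : X.Nonempty) {Y : Bool → Finset V}
    (hY : ∀ i, (Y i).Nonempty) {p α : Bool → ℝ} (hp : ∀ i, 0 < p i) (hα : ∀ i, 0 < α i)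
    (hdeg : ∀ i, ∀ x ∈ X, p i * (Y i).card ≤ (colorNbrs H i x (Y i)).card) :
    ∃ j : ℕ, ∃ i : Bool, ∃ x ∈ X, ∃ X' ⊆ X,
      (X.card : ℝ) * Real.exp (-(3 * j)) / 200 ≤ X'.card ∧
      (∀ i, ∀ y ∈ X', (p i - α i) * (colorNbrs H i x (Y i)).card ≤
        (colorNbrs H i y (colorNbrs H i x (Y i))).card) ∧
      ∀ y ∈ X', (p i + ((j : ℝ) ^ 2 / 6 - 1) * α i) * (colorNbrs H i x (Y i)).card ≤
        (colorNbrs H i y (colorNbrs H i x (Y i))).card := by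
  classical
  have hK : ∀ i, IsGramKernel
      (fun x y => 6 * (p i * (Y i).card / α i) * codegKernel H i (Y i) x y) := fun i =>
    (isGramKernel_codegKernel H i (Y i)).const_mul
      (mul_nonneg (by norm_num) (div_nonneg (mul_nonneg (hp i).le (Nat.cast_nonneg _)) (hα i).le))
  obtain ⟨j, i, x, hx, h⟩ := IsGramKernel.exists_rich_vertex hK hX
  refine ⟨j, i, x, hx, _, Finset.filter_subset _ _, h, ?_, ?_⟩
  · intro i y hy
    obtain ⟨hyX, hy6, -⟩ := Finset.mem_filter.mp hy
    have := codeg_ge_of_codegKernel_ge (μ := -1) (hp i) (hα i) (hY i) (hdeg i x hx)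
      (hdeg i y hyX) (by linarith [hy6 i])
    linarith
  · intro y hy
    obtain ⟨hyX, -, hyj⟩ := Finset.mem_filter.mp hy
    exact codeg_ge_of_codegKernel_ge (hp i) (hα i) (hY i) (hdeg i x hx)
      (hdeg i y hyX) (by linarith)

end

/-! ### The book algorithm and its potential. -/

theorem sum_bool_eq_add_not (f : Bool → ℝ) (i : Bool) : ∑ k, f k = f i + f (!i) := by
  cases i <;> simp [add_comm]

/-- The potential of a colour in the book algorithm: `s` is the number of vertices the spine still
lacks, `q` the excess of the density. -/
noncomputable def bookPotential (t : ℝ) (s : ℕ) (q : ℝ) : ℝ :=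
  -(s * Real.log (1 - 1 / t)) - Real.log q

theorem bookPotential_nonneg {t : ℝ} (ht : 1 < t) {s : ℕ} {q : ℝ} (hq : 0 < q) (hq1 : q ≤ 1) :
    0 ≤ bookPotential t s q := by
  have h1 : 1 / t < 1 := by rw [div_lt_one (by linarith)]; exact ht
  have h2 : (0 : ℝ) < 1 / t := by positivity
  have h3 := Real.log_nonpos (show 0 ≤ 1 - 1 / t by linarith) (by linarith)
  have h4 := Real.log_nonpos hq.le hq1
  have h5 : (s : ℝ) * Real.log (1 - 1 / t) ≤ 0 :=
    mul_nonpos_of_nonneg_of_nonpos (Nat.cast_nonneg _) h3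
  unfold bookPotential
  linarith

/-- A spine step is neutral: the density loss `1 - 1 / t` is prepaid by the term for the missing
vertex. Only density increments change the potential, by `bookPotential_mul`. -/
theorem bookPotential_succ {t : ℝ} (ht : 1 < t) {s : ℕ} {q : ℝ} (hq : 0 < q) :
    bookPotential t s (q * (1 - 1 / t)) = bookPotential t (s + 1) q := by
  have h1 : 1 / t < 1 := by rw [div_lt_one (by linarith)]; exact ht
  unfold bookPotential
  rw [Real.log_mul hq.ne' (by linarith)]
  push_cast
  ring

theorem bookPotential_mul {t : ℝ} {s : ℕ} {q u : ℝ} (hq : 0 < q) (hu : 0 < u) :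
    bookPotential t s (q * u) = bookPotential t s q - Real.log u := by
  unfold bookPotential
  rw [Real.log_mul hq.ne' hu.ne']
  ring

theorem nonempty_of_exp_le {V : Type} {X : Finset V} {u : ℝ} (h : Real.exp u ≤ X.card) :
    X.Nonempty := by
  rw [← Finset.card_pos]
  exact_mod_cast (Real.exp_pos u).trans_le h

theorem exp_seven_ge : (800 : ℝ) ≤ Real.exp 7 := by
  have := Real.exp_one_gt_d9
  have e : Real.exp 7 = Real.exp 1 ^ 7 := by rw [← Real.exp_nat_mul]; norm_num
  rw [e]
  calc (800 : ℝ) ≤ 2.7 ^ 7 := by norm_num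
    _ ≤ _ := pow_le_pow_left₀ (by norm_num) (by linarith) 7

theorem exp_six_ge : (400 : ℝ) ≤ Real.exp 6 := by
  have := Real.exp_one_gt_d9
  have e : Real.exp 6 = Real.exp 1 ^ 6 := by rw [← Real.exp_nat_mul]; norm_num
  rw [e]
  calc (400 : ℝ) ≤ 2.718 ^ 6 := by norm_num
    _ ≤ _ := pow_le_pow_left₀ (by norm_num) (by linarith) 6

/-- The neighbourhoods of `x` in the two colours cover `W` apart from `x`. -/
theorem card_le_colorNbrs_add {V : Type} {H : Bool → SimpleGraph V}
    (hH : ∀ x y, x ≠ y → ∃ i, (H i).Adj x y) (x : V) (W : Finset V) :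
    W.card ≤ (colorNbrs H true x W).card + (colorNbrs H false x W).card + 1 := by
  classical
  have hsub : W ⊆ insert x (colorNbrs H true x W ∪ colorNbrs H false x W) := by
    intro y hy
    by_cases hxy : x = y
    · simp [hxy]
    · obtain ⟨i, hi⟩ := hH x y hxy
      cases i <;> simp [mem_colorNbrs, hy, hi]
  have h1 := (Finset.card_le_card hsub).trans (Finset.card_insert_le _ _)
  have h2 := Finset.card_union_le (colorNbrs H true x W) (colorNbrs H false x W)
  omega

theorem exists_half_colorNbrs {V : Type} {H : Bool → SimpleGraph V}
    (hH : ∀ x y, x ≠ y → ∃ i, (H i).Adj x y) (x : V) (S : Finset V) :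
    ∃ i, ((S.card : ℝ) - 1) / 2 ≤ (colorNbrs H i x S).card := by
  by_contra! hcon
  have h3 : (S.card : ℝ) ≤ (colorNbrs H true x S).card + (colorNbrs H false x S).card + 1 := by
    exact_mod_cast card_le_colorNbrs_add hH x S
  linarith [hcon true, hcon false]

/-- The book algorithm. -/
theorem exists_book_of_potential {V : Type} {H : Bool → SimpleGraph V}
    (hH : ∀ x y, x ≠ y → ∃ i, (H i).Adj x y) {p δ κ a b c m t : ℝ} {j₀ : ℕ}
    (hκ : Real.exp (-κ) = p) (hδ : 0 < δ) (ht : 1 < t) (ha : 3 * (j₀ : ℝ) + 7 ≤ a)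
    (hb : 0 ≤ b) (hc : 0 ≤ c) (hm : 0 < m)
    (hnum : ∀ j : ℕ, j₀ < j → ((j : ℝ) ^ 2 / 6 - 1) * δ ≤ t → 0 ≤ (j : ℝ) ^ 2 / 6 - 1 ∧
      3 * (j : ℝ) + 6 ≤ b * Real.log (1 + ((j : ℝ) ^ 2 / 6 - 1) / t) ∧
      κ ≤ c * Real.log (1 + ((j : ℝ) ^ 2 / 6 - 1) / t)) (n : ℕ) :
    ∀ (X : Finset V) (Y : Bool → Finset V) (q : Bool → ℝ) (s : Bool → ℕ), X.card = n →
      (∀ i, 0 < q i) →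
      (∀ i, ∀ x ∈ X, (p + q i) * (Y i).card ≤ (colorNbrs H i x (Y i)).card) →
      (∀ i, δ ≤ q i * (1 - 1 / t) ^ s i) →
      Real.exp (∑ i, (a * s i + b * bookPotential t (s i) (q i))) ≤ X.card →
      (∀ i, Real.exp (κ * s i + c * bookPotential t (s i) (q i)) * m ≤ (Y i).card) →
      ∃ i, ∃ T ⊆ X, ∃ S ⊆ Y i, (H i).IsNClique (s i) T ∧ m ≤ S.card ∧
        ∀ u ∈ T, ∀ v ∈ S, (H i).Adj u v := by
  classical
  -- Every step removes `x` from `X`, so the size of `X` is the induction variable.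
  induction n using Nat.strong_induction_on with
  | _ n ih =>
  intro X Y q s hXn hq hdeg hqδ hXcard hYcard
  have hp : 0 < p := hκ ▸ Real.exp_pos _
  have hX : X.Nonempty := nonempty_of_exp_le hXcard
  have hYpos : ∀ i, (0 : ℝ) < (Y i).card := fun i =>
    lt_of_lt_of_le (mul_pos (Real.exp_pos _) hm) (hYcard i)
  have hY : ∀ i, (Y i).Nonempty := fun i => Finset.card_pos.mp (by exact_mod_cast hYpos i)
  have ht1 : 1 / t < 1 := by rw [div_lt_one (by linarith)]; exact ht
  have ht0 : (0 : ℝ) < 1 / t := by positivity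
  have hq1 : ∀ i, q i ≤ 1 := by
    intro i
    obtain ⟨x, hx⟩ := hX
    have h1 := hdeg i x hx
    have h2 : ((colorNbrs H i x (Y i)).card : ℝ) ≤ (Y i).card :=
      Nat.cast_le.mpr (Finset.card_le_card colorNbrs_subset)
    have h3 : (p + q i) * (Y i).card ≤ 1 * (Y i).card := by linarith
    have := le_of_mul_le_mul_right h3 (hYpos i)
    linarith
  have hL : ∀ i, 0 ≤ bookPotential t (s i) (q i) := fun i =>
    bookPotential_nonneg ht (hq i) (hq1 i)
  by_cases hs : ∃ i, s i = 0
  · obtain ⟨i, hi⟩ := hs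
    refine ⟨i, ∅, by simp, Y i, subset_rfl, by simp [hi, SimpleGraph.isNClique_iff], ?_, by simp⟩
    refine le_trans ?_ (hYcard i)
    rw [hi]
    have : 1 ≤ Real.exp (κ * ((0 : ℕ) : ℝ) + c * bookPotential t 0 (q i)) := by
      apply Real.one_le_exp
      have := hL i
      rw [hi] at this
      simp only [Nat.cast_zero, mul_zero, zero_add]
      positivity
    nlinarith
  push Not at hs
  have hs1 : ∀ i, (1 : ℝ) ≤ s i := fun i => by
    exact_mod_cast Nat.one_le_iff_ne_zero.mpr (hs i)
  have ha0 : 0 ≤ a := le_trans (by positivity) ha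
  obtain ⟨j, i, x, hx, X', hX', hcard, hall, hone⟩ :=
    exists_pivot hX hY (p := fun i => p + q i) (α := fun i => q i / t)
      (fun i => by have := hq i; positivity) (fun i => by have := hq i; positivity) hdeg
  -- Small `j`: ignore the boost and add `x` to the spine of its majority colour in `X'`, paying `a`
  -- in `X` and `κ` in `Y k`. Large `j`: replace `Y i` by the neighbourhood of `x`, paying both
  -- costs from the fall of the potential.
  by_cases hj : j ≤ j₀
  · obtain ⟨k, hk⟩ := exists_half_colorNbrs hH x X'
    set X'' := colorNbrs H k x X' with hX''
    obtain ⟨r, hr⟩ : ∃ r, s k = r + 1 := ⟨s k - 1, by have := hs k; omega⟩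
    have hpot : bookPotential t r (q k * (1 - 1 / t)) = bookPotential t (s k) (q k) := by
      rw [hr, bookPotential_succ ht (hq k)]
    have hlt : X''.card < n := by
      rw [← hXn]
      apply Finset.card_lt_card
      rw [Finset.ssubset_iff_of_subset (colorNbrs_subset.trans hX')]
      exact ⟨x, hx, not_mem_colorNbrs_self⟩
    refine (ih _ hlt X''
      (Function.update Y k (colorNbrs H k x (Y k))) (Function.update q k (q k * (1 - 1 / t)))
      (Function.update s k r) rfl ?_ ?_ ?_ ?_ ?_).elim ?_
    rotate_left 5
    · rintro i' ⟨T, hT, S, hS, hTc, hSc, hTS⟩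
      by_cases hik : i' = k
      · subst hik
        rw [Function.update_self] at hS hTc
        refine ⟨i', insert x T, ?_, S, hS.trans colorNbrs_subset, ?_, hSc, ?_⟩
        · exact Finset.insert_subset hx (hT.trans (colorNbrs_subset.trans hX'))
        · rw [hr]
          exact hTc.insert fun y hy => (mem_colorNbrs.mp (hT hy)).2
        · intro u hu v hv
          rcases Finset.mem_insert.mp hu with rfl | hu
          · exact (mem_colorNbrs.mp (hS hv)).2
          · exact hTS u hu v hv
      · rw [Function.update_of_ne hik] at hS hTc
        exact ⟨i', T, hT.trans (colorNbrs_subset.trans hX'), S, hS, hTc, hSc, hTS⟩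
    · intro i'
      by_cases hik : i' = k
      · subst hik
        rw [Function.update_self]
        exact mul_pos (hq i') (by linarith)
      · rw [Function.update_of_ne hik]; exact hq i'
    · intro i' y hy
      have hy' := (mem_colorNbrs.mp hy).1
      by_cases hik : i' = k
      · subst hik
        rw [Function.update_self, Function.update_self]
        have := hall i' y hy'
        have e : p + q i' * (1 - 1 / t) = p + q i' - q i' / t := by ring
        rw [e]; exact this
      · rw [Function.update_of_ne hik, Function.update_of_ne hik]
        exact hdeg i' y (hX' hy')
    · intro i'
      by_cases hik : i' = k
      · subst hik
        rw [Function.update_self, Function.update_self]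
        have := hqδ i'
        rw [hr, pow_succ] at this
        linarith
      · rw [Function.update_of_ne hik, Function.update_of_ne hik]
        exact hqδ i'
    · have e : ∑ i', (a * ((Function.update s k r i' : ℕ) : ℝ) + b * bookPotential t
          (Function.update s k r i') (Function.update q k (q k * (1 - 1 / t)) i'))
          = (∑ i', (a * s i' + b * bookPotential t (s i') (q i'))) - a := by
        have hnk : (!k) ≠ k := by simp
        rw [sum_bool_eq_add_not _ k, sum_bool_eq_add_not _ k, Function.update_self,
          Function.update_self, Function.update_of_ne hnk, Function.update_of_ne hnk, hpot, hr]
        push_cast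
        ring
      rw [e, Real.exp_sub]
      set E := Real.exp (∑ i', (a * s i' + b * bookPotential t (s i') (q i'))) with hE
      have hEa : Real.exp a ≤ E := by
        apply Real.exp_le_exp.mpr
        rw [sum_bool_eq_add_not _ k]
        have h1 := hs1 k
        have h2 := hL k
        have h3 := hL (!k)
        have h4 : a ≤ a * s k := le_mul_of_one_le_right ha0 h1
        have h5 : 0 ≤ b * bookPotential t (s k) (q k) := mul_nonneg hb h2
        have h6 : 0 ≤ b * bookPotential t (s !k) (q !k) := mul_nonneg hb h3
        have h7 : 0 ≤ a * s (!k) := by positivity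
        linarith
      -- `800 = 200 * 4`: a factor 2 covers halving to the majority colour, and the other absorbs
      -- the excluded `x`.
      have h1 : 800 ≤ Real.exp a * Real.exp (-(3 * j)) := by
        rw [← Real.exp_add]
        refine exp_seven_ge.trans (Real.exp_le_exp.mpr ?_)
        have : (j : ℝ) ≤ j₀ := by exact_mod_cast hj
        linarith
      have h2 : Real.exp (-(3 * (j : ℝ))) * X.card ≥ 800 * (E / Real.exp a) := by
        have h3 : 800 / Real.exp a ≤ Real.exp (-(3 * (j : ℝ))) := by
          rw [div_le_iff₀ (Real.exp_pos a)]; linarith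
        calc 800 * (E / Real.exp a) = 800 / Real.exp a * E := by ring
          _ ≤ Real.exp (-(3 * (j : ℝ))) * X.card := by
            apply mul_le_mul h3 hXcard (Real.exp_pos _).le (Real.exp_pos _).le
      have h3 : 1 ≤ E / Real.exp a := by
        rw [le_div_iff₀ (Real.exp_pos a)]; linarith
      linarith
    · intro i'
      by_cases hik : i' = k
      · subst hik
        rw [Function.update_self, Function.update_self, Function.update_self, hpot]
        have h1 := hYcard i'
        have h2 := hdeg i' x hx
        have h3 : Real.exp (κ * r + c * bookPotential t (s i') (q i')) =
            p * 0 + Real.exp (κ * s i' + c * bookPotential t (s i') (q i')) * Real.exp (-κ) := by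
          rw [← Real.exp_add, hr]; push_cast; ring_nf
        have h4 := mul_le_mul_of_nonneg_left h1 hp.le
        have h5 := hq i'
        have h6 := hYpos i'
        rw [h3, hκ]
        nlinarith
      · rw [Function.update_of_ne hik, Function.update_of_ne hik, Function.update_of_ne hik]
        exact hYcard i'
  · push Not at hj
    set l : ℝ := (j : ℝ) ^ 2 / 6 - 1 with hl
    have hX'pos : (0 : ℝ) < X'.card := by
      refine lt_of_lt_of_le ?_ hcard
      have : (0 : ℝ) < X.card := by exact_mod_cast hX.card_pos
      positivity
    obtain ⟨y₀, hy₀⟩ : X'.Nonempty := Finset.card_pos.mp (by exact_mod_cast hX'pos)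
    have hYx : p * (Y i).card ≤ (colorNbrs H i x (Y i)).card := by
      have := hdeg i x hx
      have := hq i
      have := hYpos i
      nlinarith
    have hYxpos : (0 : ℝ) < (colorNbrs H i x (Y i)).card :=
      lt_of_lt_of_le (mul_pos hp (hYpos i)) hYx
    -- A boosted density cannot exceed 1. With `δ ≤ q i` this bounds `l`, as `hnum` requires, and
    -- keeps the new potential nonnegative.
    have hle1 : p + q i + l * (q i / t) ≤ 1 := by
      have h1 := hone y₀ hy₀
      have h2 : ((colorNbrs H i y₀ (colorNbrs H i x (Y i))).card : ℝ) ≤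
          (colorNbrs H i x (Y i)).card := Nat.cast_le.mpr (Finset.card_le_card colorNbrs_subset)
      have h3 : (p + q i + l * (q i / t)) * (colorNbrs H i x (Y i)).card ≤
          1 * (colorNbrs H i x (Y i)).card := by linarith
      exact le_of_mul_le_mul_right h3 hYxpos
    have hδq : δ ≤ q i := by
      refine (hqδ i).trans ?_
      exact mul_le_of_le_one_right (hq i).le (pow_le_one₀ (by linarith) (by linarith))
    have hlδ : l * δ ≤ t := by
      rcases lt_or_ge l 0 with h | h
      · nlinarith
      · have h1 : l * (q i / t) ≤ 1 := by linarith [hq i]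
        have h2 : l * q i ≤ t := by
          have e : l * (q i / t) = l * q i / t := by ring
          rw [e, div_le_one (by linarith)] at h1
          exact h1
        exact (mul_le_mul_of_nonneg_left hδq h).trans h2
    obtain ⟨hl0, hbl, hcl⟩ := hnum j hj hlδ
    have hu : 1 ≤ 1 + l / t := by
      have : 0 ≤ l / t := div_nonneg hl0 (by linarith)
      linarith
    have hq' : q i * (1 + l / t) ≤ 1 := by
      have e : q i * (1 + l / t) = q i + l * (q i / t) := by ring
      linarith
    have hpot := bookPotential_mul (t := t) (s := s i) (hq i) (show 0 < 1 + l / t by linarith)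
    have hpot0 : 0 ≤ bookPotential t (s i) (q i * (1 + l / t)) :=
      bookPotential_nonneg ht (mul_pos (hq i) (by linarith)) hq'
    set ℓ := Real.log (1 + l / t) with hℓ
    set X'' := X'.erase x with hX''
    have hsub : X'' ⊆ X := (Finset.erase_subset _ _).trans hX'
    have hlt : X''.card < n := by
      rw [← hXn]
      apply Finset.card_lt_card
      rw [Finset.ssubset_iff_of_subset hsub]
      exact ⟨x, hx, Finset.notMem_erase x X'⟩
    refine (ih _ hlt X''
      (Function.update Y i (colorNbrs H i x (Y i))) (Function.update q i (q i * (1 + l / t)))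
      s rfl ?_ ?_ ?_ ?_ ?_).elim ?_
    rotate_left 5
    · rintro i' ⟨T, hT, S, hS, hTc, hSc, hTS⟩
      refine ⟨i', T, hT.trans hsub, S, hS.trans ?_, hTc, hSc, hTS⟩
      by_cases hik : i' = i
      · subst hik
        rw [Function.update_self]
        exact colorNbrs_subset
      · rw [Function.update_of_ne hik]
    · intro i'
      by_cases hik : i' = i
      · subst hik
        rw [Function.update_self]
        exact mul_pos (hq i') (by linarith)
      · rw [Function.update_of_ne hik]; exact hq i'
    · intro i' y hy
      by_cases hik : i' = i
      · subst hik
        rw [Function.update_self, Function.update_self]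
        have := hone y (Finset.mem_of_mem_erase hy)
        have e : p + q i' * (1 + l / t) = p + q i' + l * (q i' / t) := by ring
        rw [e]; exact this
      · rw [Function.update_of_ne hik, Function.update_of_ne hik]
        exact hdeg i' y (hsub hy)
    · intro i'
      by_cases hik : i' = i
      · subst hik
        rw [Function.update_self]
        refine (hqδ i').trans ?_
        exact mul_le_mul_of_nonneg_right (le_mul_of_one_le_right (hq i').le hu)
          (pow_nonneg (by linarith) _)
      · rw [Function.update_of_ne hik]
        exact hqδ i'
    · have e : ∑ i', (a * s i' + b * bookPotential t (s i')
          (Function.update q i (q i * (1 + l / t)) i'))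
          = (∑ i', (a * s i' + b * bookPotential t (s i') (q i'))) - b * ℓ := by
        have hnk : (!i) ≠ i := by simp
        rw [sum_bool_eq_add_not _ i, sum_bool_eq_add_not _ i, Function.update_self,
          Function.update_of_ne hnk, hpot]
        ring
      rw [e, Real.exp_sub]
      set E := Real.exp (∑ i', (a * s i' + b * bookPotential t (s i') (q i'))) with hE
      have hEa : Real.exp (b * ℓ) ≤ E := by
        apply Real.exp_le_exp.mpr
        rw [sum_bool_eq_add_not _ i]
        have h3 := hL (!i)
        have h5 : b * ℓ ≤ b * bookPotential t (s i) (q i) :=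
          mul_le_mul_of_nonneg_left (by linarith) hb
        have h6 : 0 ≤ b * bookPotential t (s !i) (q !i) := mul_nonneg hb h3
        have h7 : 0 ≤ a * s (!i) := by positivity
        have h8 : 0 ≤ a * s i := by positivity
        linarith
      have h1 : 400 ≤ Real.exp (b * ℓ) * Real.exp (-(3 * j)) := by
        rw [← Real.exp_add]
        refine exp_six_ge.trans (Real.exp_le_exp.mpr ?_)
        linarith
      have h2 : Real.exp (-(3 * (j : ℝ))) * X.card ≥ 400 * (E / Real.exp (b * ℓ)) := by
        have h3 : 400 / Real.exp (b * ℓ) ≤ Real.exp (-(3 * (j : ℝ))) := by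
          rw [div_le_iff₀ (Real.exp_pos _)]; linarith
        calc 400 * (E / Real.exp (b * ℓ)) = 400 / Real.exp (b * ℓ) * E := by ring
          _ ≤ Real.exp (-(3 * (j : ℝ))) * X.card := by
            apply mul_le_mul h3 hXcard (Real.exp_pos _).le (Real.exp_pos _).le
      have h3 : 1 ≤ E / Real.exp (b * ℓ) := by
        rw [le_div_iff₀ (Real.exp_pos _)]; linarith
      have h4 : (X'.card : ℝ) ≤ X''.card + 1 := by
        have h5 : X'.card ≤ X''.card + 1 := Nat.le_add_of_sub_le Finset.pred_card_le_card_erase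
        exact_mod_cast h5
      linarith
    · intro i'
      by_cases hik : i' = i
      · subst hik
        rw [Function.update_self, Function.update_self, hpot]
        have h1 := hYcard i'
        have h3 : Real.exp (κ * s i' + c * (bookPotential t (s i') (q i') - ℓ)) ≤
            Real.exp (κ * s i' + c * bookPotential t (s i') (q i')) * Real.exp (-κ) := by
          rw [← Real.exp_add]
          apply Real.exp_le_exp.mpr
          linarith
        rw [hκ] at h3
        have h4 := mul_le_mul_of_nonneg_left h1 hp.le
        have h5 := mul_le_mul_of_nonneg_right h3 hm.le
        linarith
      · rw [Function.update_of_ne hik, Function.update_of_ne hik]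
        exact hYcard i'

/-! ### Erdős–Szekeres recursion and the saving of one. -/

/-- Every two-colouring of at least `n` vertices has a clique of size `a` in the colour `true` or a
clique of size `b` in the colour `false`. -/
def Forces (a b n : ℕ) : Prop :=
  ∀ (V : Type) (H : Bool → SimpleGraph V), (∀ x y, x ≠ y → ∃ i, (H i).Adj x y) →
    ∀ W : Finset V, n ≤ W.card →
      (∃ T ⊆ W, (H true).IsNClique a T) ∨ (∃ T ⊆ W, (H false).IsNClique b T)

namespace Forces

variable {a b m n : ℕ}

theorem mono (h : Forces a b m) (hmn : m ≤ n) : Forces a b n := fun V H hH W hW =>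
  h V H hH W (hmn.trans hW)

theorem symm (h : Forces a b n) : Forces b a n := fun V H hH W hW =>
  (h V (fun i => H (!i)) (fun x y hxy => by
    obtain ⟨i, hi⟩ := hH x y hxy
    exact ⟨!i, by simpa using hi⟩) W hW).symm

theorem one_left (b : ℕ) : Forces 1 b 1 := fun V H _ W hW => by
  obtain ⟨v, hv⟩ := Finset.card_pos.mp hW
  exact Or.inl ⟨{v}, by simpa using hv, by simp [SimpleGraph.isNClique_iff]⟩

/-- Extending a clique inside a neighbourhood. -/
theorem insert_clique {V : Type} {H : Bool → SimpleGraph V} {i : Bool} {x : V} {W T : Finset V}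
    {c : ℕ} (hx : x ∈ W) (hT : T ⊆ colorNbrs H i x W) (hc : (H i).IsNClique c T) :
    ∃ T ⊆ W, (H i).IsNClique (c + 1) T := by
  classical
  exact ⟨insert x T, Finset.insert_subset hx (hT.trans colorNbrs_subset),
    hc.insert fun y hy => (mem_colorNbrs.mp (hT hy)).2⟩

theorem of_nbrs_left (h : Forces a b n) {V : Type} {H : Bool → SimpleGraph V}
    (hH : ∀ x y, x ≠ y → ∃ i, (H i).Adj x y) {x : V} {W : Finset V} (hx : x ∈ W)
    (hn : n ≤ (colorNbrs H true x W).card) :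
    (∃ T ⊆ W, (H true).IsNClique (a + 1) T) ∨ (∃ T ⊆ W, (H false).IsNClique b T) := by
  rcases h V H hH _ hn with ⟨T, hT, hc⟩ | ⟨T, hT, hc⟩
  · exact Or.inl (insert_clique hx hT hc)
  · exact Or.inr ⟨T, hT.trans colorNbrs_subset, hc⟩

theorem of_nbrs_right (h : Forces a b n) {V : Type} {H : Bool → SimpleGraph V}
    (hH : ∀ x y, x ≠ y → ∃ i, (H i).Adj x y) {x : V} {W : Finset V} (hx : x ∈ W)
    (hn : n ≤ (colorNbrs H false x W).card) :
    (∃ T ⊆ W, (H true).IsNClique a T) ∨ (∃ T ⊆ W, (H false).IsNClique (b + 1) T) := by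
  rcases h V H hH _ hn with ⟨T, hT, hc⟩ | ⟨T, hT, hc⟩
  · exact Or.inl ⟨T, hT.trans colorNbrs_subset, hc⟩
  · exact Or.inr (insert_clique hx hT hc)

theorem step (h₁ : Forces a (b + 1) m) (h₂ : Forces (a + 1) b n) (hmn : 0 < m + n) :
    Forces (a + 1) (b + 1) (m + n) := fun V H hH W hW => by
  obtain ⟨x, hx⟩ := Finset.card_pos.mp (hmn.trans_le hW)
  have := card_le_colorNbrs_add hH x W
  by_cases h : m ≤ (colorNbrs H true x W).card
  · exact h₁.of_nbrs_left hH hx h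
  · exact h₂.of_nbrs_right hH hx (by omega)

theorem choose (a b : ℕ) : Forces (a + 1) (b + 1) ((a + b).choose a) := by
  induction a generalizing b with
  | zero => simpa using one_left (b + 1)
  | succ a iha =>
    induction b with
    | zero => simpa using (one_left (a + 1 + 1)).symm
    | succ b ihb =>
      have h := (iha (b + 1)).step ihb
        (Nat.add_pos_left (Nat.choose_pos (Nat.le_add_right _ _)) _)
      have e : (a + 1 + (b + 1)).choose (a + 1)
          = (a + (b + 1)).choose a + (a + 1 + b).choose (a + 1) := by
        rw [show a + 1 + (b + 1) = (a + (b + 1)) + 1 by ring, Nat.choose_succ_succ,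
          show a + (b + 1) = a + 1 + b by ring]
      rw [e]
      exact h

/-- `R(3, 4) ≤ 9`. -/
theorem three_four : Forces 3 4 9 := fun V H hH W' hW' => by
  classical
  -- Exactly nine vertices are needed: without the cliques the colour `true` would be 3-regular on
  -- them, with odd degree sum 27.
  obtain ⟨W, hWW', hW⟩ := Finset.exists_subset_card_eq hW'
  by_contra! hcon
  have hno : ¬ ((∃ T ⊆ W, (H true).IsNClique 3 T) ∨ (∃ T ⊆ W, (H false).IsNClique 4 T)) := by
    rintro (⟨T, hT, h⟩ | ⟨T, hT, h⟩)
    · exact hcon.1 T (hT.trans hWW') h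
    · exact hcon.2 T (hT.trans hWW') h
  have h24 : Forces 2 4 4 := Forces.choose 1 3
  have h33 : Forces 3 3 6 := Forces.choose 2 2
  have hdeg : ∀ x ∈ W, (colorNbrs H true x W).card = 3 := by
    intro x hx
    have h1 := card_le_colorNbrs_add hH x W
    have h2 : (colorNbrs H true x W).card < 4 := by
      by_contra! h
      exact hno (h24.of_nbrs_left hH hx h)
    have h3 : (colorNbrs H false x W).card < 6 := by
      by_contra! h
      exact hno (h33.of_nbrs_right hH hx h)
    omega
  have hsum := ((H true).induce (W : Set V)).sum_degrees_eq_twice_card_edges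
  have hd : ∀ v : (W : Set V), ((H true).induce (W : Set V)).degree v = 3 := by
    intro v
    rw [← hdeg v v.2, ← SimpleGraph.card_neighborFinset_eq_degree]
    refine Finset.card_bij (fun w _ => (w : V)) ?_ ?_ ?_
    · intro w hw
      rw [SimpleGraph.mem_neighborFinset] at hw
      exact mem_colorNbrs.mpr ⟨w.2, hw⟩
    · intro w _ w' _ h
      exact Subtype.ext h
    · intro w hw
      obtain ⟨h1, h2⟩ := mem_colorNbrs.mp hw
      exact ⟨⟨w, h1⟩, by rw [SimpleGraph.mem_neighborFinset]; exact h2, rfl⟩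
  rw [Finset.sum_congr rfl fun v _ => hd v, Finset.sum_const, Finset.card_univ] at hsum
  simp only [Finset.coe_sort_coe, Fintype.card_coe, hW, smul_eq_mul] at hsum
  omega

/-- Pascal's rule carries the unit saved at `(3, 4)` to all larger pairs; only one of the two
summands has to save it. -/
theorem choose_sub_one (a b : ℕ) : Forces (a + 3) (b + 4) ((a + b + 5).choose (a + 2) - 1) := by
  induction a generalizing b with
  | zero =>
    induction b with
    | zero => exact three_four.mono (by decide)
    | succ b ihb =>
      have h := (Forces.choose 1 (b + 4)).step ihb
        (Nat.add_pos_left (Nat.choose_pos (by omega)) _)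
      refine h.mono ?_
      have hpos : 0 < (0 + b + 5).choose (0 + 2) := Nat.choose_pos (by omega)
      have e : (0 + (b + 1) + 5).choose (0 + 2)
          = (1 + (b + 4)).choose 1 + (0 + b + 5).choose (0 + 2) := by
        rw [show 0 + (b + 1) + 5 = (0 + b + 5) + 1 by ring, Nat.choose_succ_succ,
          show 1 + (b + 4) = 0 + b + 5 by ring]
      omega
  | succ a iha =>
    have h := (iha b).step (Forces.choose (a + 3) (b + 2))
        (Nat.add_pos_right _ (Nat.choose_pos (by omega)))
    refine h.mono ?_
    have hpos : 0 < (a + b + 5).choose (a + 2) := Nat.choose_pos (by omega)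
    have e : (a + 1 + b + 5).choose (a + 1 + 2)
        = (a + b + 5).choose (a + 2) + (a + 3 + (b + 2)).choose (a + 3) := by
      rw [show a + 1 + b + 5 = (a + b + 5) + 1 by ring, Nat.choose_succ_succ,
        show a + 3 + (b + 2) = a + b + 5 by ring]
    omega

theorem ramseyNumber_le (h : Forces a b n) (hn : 0 < n) : ramseyNumber a b ≤ n := by
  classical
  refine Nat.find_min' _ ⟨hn, fun G => ?_⟩
  rcases h (Fin n) (fun i => bif i then G else Gᶜ) (fun x y hxy => by
    by_cases hG : G.Adj x y
    · exact ⟨true, hG⟩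
    · exact ⟨false, hxy, hG⟩) Finset.univ (by simp) with ⟨T, -, hT⟩ | ⟨T, -, hT⟩
  · exact Or.inl ⟨T, hT⟩
  · exact Or.inr ⟨T, by rw [← SimpleGraph.isNClique_compl]; exact hT⟩

end Forces

/-! ### Analytic estimates. -/

/-- Chernoff's bound: compare one term of `(exp s + 1) ^ n` with the whole, and use `cosh u ≤ exp (u
^ 2 / 2)` at `u = s / 2`. -/
theorem choose_le_two_pow_mul_exp (n j : ℕ) (s : ℝ) :
    (n.choose j : ℝ) ≤ 2 ^ n * Real.exp (-(s * (j - n / 2)) + n * s ^ 2 / 8) := by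
  rcases lt_or_ge n j with h | h
  · rw [Nat.choose_eq_zero_of_lt h, Nat.cast_zero]
    positivity
  have h1 : (n.choose j : ℝ) * Real.exp (s * j) ≤ (Real.exp s + 1) ^ n := by
    rw [add_pow]
    have := Finset.single_le_sum (f := fun m => Real.exp s ^ m * 1 ^ (n - m) * (n.choose m : ℝ))
      (fun m _ => by positivity) (Finset.mem_range.mpr (Nat.lt_succ_of_le h))
    refine le_trans (le_of_eq ?_) this
    rw [← Real.exp_nat_mul]
    ring_nf
  have h2 : Real.exp s + 1 ≤ 2 * Real.exp (s / 2 + s ^ 2 / 8) := by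
    have := Real.cosh_le_exp_half_sq (s / 2)
    have e : Real.exp s + 1 = 2 * (Real.exp (s / 2) * Real.cosh (s / 2)) := by
      rw [Real.cosh_eq]
      have e1 : Real.exp (s / 2) * Real.exp (s / 2) = Real.exp s := by
        rw [← Real.exp_add]; ring_nf
      have e2 : Real.exp (s / 2) * Real.exp (-(s / 2)) = 1 := by
        rw [← Real.exp_add]; simp
      linear_combination -e1 - e2
    rw [e, Real.exp_add]
    have e3 : (s / 2) ^ 2 / 2 = s ^ 2 / 8 := by ring
    rw [e3] at this
    have := mul_le_mul_of_nonneg_left this (Real.exp_pos (s / 2)).le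
    linarith
  have h3 := pow_le_pow_left₀ (by positivity) h2 n
  rw [mul_pow, ← Real.exp_nat_mul] at h3
  have h4 : (n.choose j : ℝ) ≤ 2 ^ n * Real.exp (n * (s / 2 + s ^ 2 / 8)) / Real.exp (s * j) := by
    rw [le_div_iff₀ (Real.exp_pos _)]
    exact h1.trans h3
  refine h4.trans (le_of_eq ?_)
  rw [mul_div_assoc, ← Real.exp_sub]
  ring_nf

theorem half_le_log_one_add {x : ℝ} (hx : 0 ≤ x) : min x 1 / 2 ≤ Real.log (1 + x) := by
  refine le_trans ?_ (Real.le_log_one_add_of_nonneg hx)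
  rw [div_le_div_iff₀ (by norm_num) (by linarith)]
  rcases le_total x 1 with h | h
  · rw [min_eq_left h]; nlinarith
  · rw [min_eq_right h]; nlinarith

theorem neg_two_le_mul_log_one_sub_inv {t : ℝ} (ht : 2 ≤ t) : -2 ≤ t * Real.log (1 - 1 / t) := by
  have h1 : 0 < 1 - 1 / t := by
    have : 1 / t < 1 := by rw [div_lt_one (by linarith)]; linarith
    linarith
  have h2 := Real.one_sub_inv_le_log_of_pos h1
  have h3 : 1 - (1 - 1 / t)⁻¹ = -(1 / (t - 1)) := by
    have : t - 1 ≠ 0 := by linarith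
    have : t ≠ 0 := by linarith
    field_simp
    ring
  rw [h3] at h2
  have h4 : t * (1 / (t - 1)) ≤ 2 := by
    rw [mul_one_div, div_le_iff₀ (by linarith)]; linarith
  have := mul_le_mul_of_nonneg_left h2 (show 0 ≤ t by linarith)
  linarith

theorem two_pow_le_exp (n : ℕ) : (2 : ℝ) ^ n ≤ Real.exp n := by
  have h := pow_le_pow_left₀ (by norm_num) (show (2 : ℝ) ≤ Real.exp 1 by
    linarith [Real.exp_one_gt_d9]) n
  rwa [← Real.exp_nat_mul, mul_one] at h

/-! ### Books in nearly regular colourings. -/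

/-- In a nearly regular colouring there is a large monochromatic book. -/
theorem exists_book {V : Type} {H : Bool → SimpleGraph V}
    (hH : ∀ x y, x ≠ y → ∃ i, (H i).Adj x y) {t : ℕ} (ht : (5 * 10 ^ 37 : ℝ) ≤ t)
    {W : Finset V} {m : ℝ} (hm : 0 < m)
    (hdeg : ∀ i, ∀ x ∈ W, (1 / 2 - 2 * (1 / (5 * 10 ^ 17)) : ℝ) * W.card ≤
      (colorNbrs H i x W).card)
    (hX : Real.exp (7 * 10 ^ 10 * t) ≤ W.card)
    (hY : Real.exp (t * (Real.log 2 + 55 / 10 ^ 18)) * m ≤ W.card) :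
    ∃ i, ∃ T ⊆ W, ∃ S ⊆ W, (H i).IsNClique t T ∧ m ≤ S.card ∧
      ∀ u ∈ T, ∀ v ∈ S, (H i).Adj u v := by
  set ε : ℝ := 1 / (5 * 10 ^ 17) with hε
  have hεpos : 0 < ε := by positivity
  clear_value ε
  -- One `ε` below the guaranteed density, so the algorithm starts with excess `q = ε`.
  obtain ⟨p, hp⟩ : ∃ p : ℝ, p = 1 / 2 - 3 * ε := ⟨_, rfl⟩
  have hppos : 1 / 4 ≤ p := by rw [hp, hε]; norm_num
  have htpos : (0 : ℝ) < t := by linarith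
  have hlogε : -Real.log ε ≤ 60 := by
    rw [hε, one_div, Real.log_inv, neg_neg, Real.log_le_iff_le_exp (by norm_num)]
    have := two_pow_le_exp 60
    push_cast at this
    exact le_trans (by norm_num) this
  have hlogt := neg_two_le_mul_log_one_sub_inv (show (2 : ℝ) ≤ t by linarith)
  have hL : bookPotential t t ε ≤ 83 := by
    unfold bookPotential; linarith
  have hκ1 : -Real.log p ≤ 3 / 2 := by
    have h1 : Real.log (1 / 4) ≤ Real.log p := Real.log_le_log (by norm_num) hppos
    have h2 : Real.log (1 / 4) = -(2 * Real.log 2) := by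
      rw [one_div, Real.log_inv, show (4 : ℝ) = 2 ^ 2 by norm_num, Real.log_pow]
      push_cast; ring
    linarith [Real.log_two_lt_d9]
  have hκ2 : -Real.log p ≤ Real.log 2 + 12 * ε := by
    have h1 : p = (1 / 2) * (1 - 6 * ε) := by rw [hp]; ring
    have h6 : 0 < 1 - 6 * ε := by rw [hε]; norm_num
    rw [h1, Real.log_mul (by norm_num) h6.ne', one_div, Real.log_inv]
    have h2 := Real.one_sub_inv_le_log_of_pos h6
    have h3 : (1 - 6 * ε)⁻¹ ≤ 1 + 12 * ε := by
      rw [inv_le_iff_one_le_mul₀ h6, hε]; norm_num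
    linarith
  have hj : ∀ j : ℕ, 10 ^ 10 < j → ((j : ℝ) ^ 2 / 6 - 1) * (ε / 8) ≤ t →
      0 ≤ (j : ℝ) ^ 2 / 6 - 1 ∧
      3 * (j : ℝ) + 6 ≤ (120 * t / 10 ^ 10) * Real.log (1 + ((j : ℝ) ^ 2 / 6 - 1) / t) ∧
      -Real.log p ≤ (36 * t / 10 ^ 20) * Real.log (1 + ((j : ℝ) ^ 2 / 6 - 1) / t) := by
    intro j hj hjt
    have hj' : (10 ^ 10 : ℝ) ≤ j := by exact_mod_cast hj.le
    set l : ℝ := (j : ℝ) ^ 2 / 6 - 1 with hl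
    have hl1 : (j : ℝ) ^ 2 / 12 ≤ l := by rw [hl]; nlinarith
    have hl0 : 0 ≤ l := le_trans (by positivity) hl1
    have hlog := half_le_log_one_add (show 0 ≤ l / t by positivity)
    refine ⟨hl0, ?_, ?_⟩
    · refine le_trans ?_ (mul_le_mul_of_nonneg_left hlog (by positivity))
      rcases le_total (l / t) 1 with h | h
      · rw [min_eq_left h]
        have e : 120 * (t : ℝ) / 10 ^ 10 * (l / t / 2) = 60 * l / 10 ^ 10 := by
          field_simp; ring
        rw [e, le_div_iff₀ (by positivity)]
        nlinarith
      · rw [min_eq_right h]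
        have h1 : (j : ℝ) ^ 2 ≤ 48 * 10 ^ 18 * t := by
          have : l ≤ 4 * 10 ^ 18 * t := by
            rw [hε] at hjt
            linarith
          linarith
        -- The lower bound `5 * 10 ^ 37 ≤ t` is needed here: squaring asks for `48 * 10 ^ 38 * t ≤
        -- 144 * t ^ 2`.
        have h2 : (j : ℝ) * 10 ^ 10 ≤ 12 * t := by
          refine le_of_sq_le_sq ?_ (by positivity)
          nlinarith
        linarith
    · refine hκ1.trans (le_trans ?_ (mul_le_mul_of_nonneg_left hlog (by positivity)))
      rcases le_total (l / t) 1 with h | h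
      · rw [min_eq_left h]
        have e : 36 * (t : ℝ) / 10 ^ 20 * (l / t / 2) = 18 * l / 10 ^ 20 := by
          field_simp; ring
        rw [e, le_div_iff₀ (by positivity)]
        nlinarith
      · rw [min_eq_right h]
        linarith
  have h8 : 1 / 8 ≤ (1 - 1 / (t : ℝ)) ^ t := by
    have h1 : 0 < 1 - 1 / (t : ℝ) := by
      have : 1 / (t : ℝ) < 1 := by rw [div_lt_one htpos]; linarith
      linarith
    rw [← Real.exp_log (pow_pos h1 t), Real.log_pow]
    refine le_trans ?_ (Real.exp_le_exp.mpr hlogt)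
    rw [Real.exp_neg, one_div]
    refine inv_anti₀ (Real.exp_pos _) ?_
    have : Real.exp 2 = Real.exp 1 * Real.exp 1 := by rw [← Real.exp_add]; norm_num
    rw [this]
    nlinarith [Real.exp_one_lt_d9, Real.exp_pos 1]
  -- In `X`, the two spines cost about `6 * 10 ^ 10 * t` and the potentials little more. In `Y`, the
  -- excess over `t * log 2` is at most `12 * ε * t + 83 * c`, below `55 * t / 10 ^ 18`.
  obtain ⟨i, T, hT, S, hS, h⟩ := exists_book_of_potential hH (p := p) (δ := ε / 8)
    (κ := -Real.log p) (a := 3 * ((10 ^ 10 : ℕ) : ℝ) + 7) (b := 120 * t / 10 ^ 10)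
    (c := 36 * t / 10 ^ 20) (m := m) (t := t) (j₀ := 10 ^ 10)
    (by rw [neg_neg, Real.exp_log (by linarith)]) (by positivity) (by linarith) le_rfl
    (by positivity) (by positivity) hm hj W.card W (fun _ => W) (fun _ => ε) (fun _ => t) rfl
    (fun _ => hεpos) (fun i x hx => by
      have := hdeg i x hx
      rw [hp]
      have e : (1 / 2 - 3 * ε + ε) = 1 / 2 - 2 * ε := by ring
      rw [e]; exact this)
    (fun _ => by nlinarith)
    (by
      refine le_trans (Real.exp_le_exp.mpr ?_) hX
      rw [Fintype.sum_bool]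
      have h1 := mul_le_mul_of_nonneg_left hL (show 0 ≤ 120 * (t : ℝ) / 10 ^ 10 by positivity)
      push_cast
      linarith)
    (fun _ => by
      refine le_trans (mul_le_mul_of_nonneg_right (Real.exp_le_exp.mpr ?_) hm.le) hY
      have h1 := mul_le_mul_of_nonneg_left hL (show 0 ≤ 36 * (t : ℝ) / 10 ^ 20 by positivity)
      have h2 := mul_le_mul_of_nonneg_right hκ2 htpos.le
      rw [hε] at h2
      linarith)
  exact ⟨i, T, hT, S, hS, h⟩

theorem Forces.choose_of_pos {a b : ℕ} (ha : 0 < a) (hb : 0 < b) :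
    Forces a b ((a + b).choose a) := by
  obtain ⟨a, rfl⟩ : ∃ a', a = a' + 1 := ⟨a - 1, by omega⟩
  obtain ⟨b, rfl⟩ : ∃ b', b = b' + 1 := ⟨b - 1, by omega⟩
  refine (Forces.choose a b).mono ?_
  calc (a + b).choose a ≤ (a + b + 1).choose (a + 1) := by
        rw [Nat.choose_succ_succ]; exact Nat.le_add_right _ _
    _ ≤ (a + 1 + (b + 1)).choose (a + 1) := Nat.choose_le_choose _ (by omega)

theorem isNClique_union {V : Type} [DecidableEq V] {G : SimpleGraph V} {T S : Finset V} {c d : ℕ}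
    (hT : G.IsNClique c T) (hS : G.IsNClique d S) (h : ∀ u ∈ T, ∀ v ∈ S, G.Adj u v) :
    G.IsNClique (c + d) (T ∪ S) := by
  rw [SimpleGraph.isNClique_iff] at hT hS ⊢
  refine ⟨?_, ?_⟩
  · intro x hx y hy hxy
    rw [Finset.mem_coe, Finset.mem_union] at hx hy
    rcases hx with hx | hx <;> rcases hy with hy | hy
    · exact hT.1 hx hy hxy
    · exact h x hx y hy
    · exact (h y hy x hx).symm
    · exact hS.1 hx hy hxy
  · rw [Finset.card_union_of_disjoint, hT.2, hS.2]
    rw [Finset.disjoint_left]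
    exact fun x hx hx' => G.irrefl (h x hx x hx')

/-- Removing `t` from one side puts `b` at least `3 * t / 8` above the middle. Chernoff with `s = t
/ k` saves the exponent `(3/8 - 1/4) * t ^ 2 / k ≥ t / (16 * 10 ^ 15)`, which is `62.5 * t / 10 ^
18`. -/
theorem choose_add_sub_le {a b k t : ℕ} (ht : 0 < t) (hkt : (k : ℝ) ≤ 2 * 10 ^ 15 * t)
    (hta : t ≤ a) (ha : a ≤ k) (hb : b ≤ k) (hab : 4 * a ≤ 4 * b + t) :
    ((a - t + b).choose (a - t) : ℝ) ≤
      2 ^ (a + b) * Real.exp (-(t * (Real.log 2 + 62 / 10 ^ 18))) := by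
  have hk : (0 : ℝ) < k := by exact_mod_cast (ht.trans_le hta).trans_le ha
  have ht' : (0 : ℝ) < t := by exact_mod_cast ht
  have h := choose_le_two_pow_mul_exp (a - t + b) b (t / k)
  rw [Nat.choose_symm_add]
  refine h.trans ?_
  have e : (2 : ℝ) ^ (a - t + b) = 2 ^ (a + b) * Real.exp (-(t * Real.log 2)) := by
    have : (2 : ℝ) ^ (a + b) = 2 ^ (a - t + b) * 2 ^ t := by
      rw [← pow_add]; congr 1; omega
    rw [this, Real.exp_neg, Real.exp_nat_mul, Real.exp_log (by norm_num), mul_assoc,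
      mul_inv_cancel₀ (by positivity), mul_one]
  rw [e, mul_assoc, ← Real.exp_add]
  refine mul_le_mul_of_nonneg_left (Real.exp_le_exp.mpr ?_) (by positivity)
  have hcast : ((a - t + b : ℕ) : ℝ) = a - t + b := by
    rw [Nat.cast_add, Nat.cast_sub hta]
  rw [hcast]
  have hab' : 4 * (a : ℝ) ≤ 4 * b + t := by exact_mod_cast hab
  have ha' : (a : ℝ) ≤ k := by exact_mod_cast ha
  have hb' : (b : ℝ) ≤ k := by exact_mod_cast hb
  have h1 : (t : ℝ) / k * (3 * t / 8) ≤ t / k * (b - (a - t + b) / 2) :=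
    mul_le_mul_of_nonneg_left (by linarith) (by positivity)
  have h2 : ((a : ℝ) - t + b) * (t / k) ^ 2 / 8 ≤ (2 * k) * (t / k) ^ 2 / 8 := by
    have := mul_le_mul_of_nonneg_right (show (a : ℝ) - t + b ≤ 2 * k by linarith)
      (sq_nonneg ((t : ℝ) / k))
    linarith
  have h3 : (2 * (k : ℝ)) * (t / k) ^ 2 / 8 = t / k * (t / 4) := by field_simp; ring
  have h4 : (1 : ℝ) / (2 * 10 ^ 15) ≤ t / k := by
    rw [div_le_div_iff₀ (by positivity) hk]; linarith
  have h5 := mul_le_mul_of_nonneg_right h4 ht'.le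
  linarith

/-! ### Density gains, then a book: the exponential improvement. -/

/-- Cliques from Erdős–Szekeres steps with a density gain followed by a monochromatic book. -/
theorem exists_clique_of_density {V : Type} {H : Bool → SimpleGraph V}
    (hH : ∀ x y, x ≠ y → ∃ i, (H i).Adj x y) {k t : ℕ} (ht : (5 * 10 ^ 37 : ℝ) ≤ t)
    (hkt : 10 ^ 15 * t ≤ k) (hkt' : k ≤ 2 * 10 ^ 15 * t) (u : ℕ) :
    ∀ (a b : ℕ) (W : Finset V), k + u ≤ a + t / 4 → k + u ≤ b + t / 4 → a ≤ k → b ≤ k →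
      (2 : ℝ) ^ (a + b) ≤ W.card * (1 + 2 * (1 / (5 * 10 ^ 17)) : ℝ) ^ u →
      (∃ T ⊆ W, (H true).IsNClique a T) ∨ (∃ T ⊆ W, (H false).IsNClique b T) := by
  classical
  have ht0 : 0 < t := by
    have : (0 : ℝ) < t := by linarith
    exact_mod_cast this
  induction u with
  | zero =>
    intro a b W hka hkb ha hb hW
    refine Forces.choose_of_pos (by omega) (by omega) V H hH W ?_
    have h1 : ((a + b).choose a : ℝ) ≤ 2 ^ (a + b) := by
      exact_mod_cast Nat.choose_le_two_pow _ _
    rw [pow_zero, mul_one] at hW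
    exact_mod_cast h1.trans hW
  | succ u ih =>
    intro a b W hka hkb ha hb hW
    set ε : ℝ := 1 / (5 * 10 ^ 17) with hε
    have hεpos : 0 < ε := by positivity
    clear_value ε
    -- `u` counts the gains still needed; at most `t / 4` steps keep `a` and `b` within `t / 4` of
    -- each other.
    by_cases hheavy : ∃ i, ∃ x ∈ W, (1 / 2 + ε) * W.card ≤ (colorNbrs H i x W).card
    · obtain ⟨i, x, hx, hxW⟩ := hheavy
      have hgain : (2 : ℝ) ^ (a + b) ≤ 2 * ((colorNbrs H i x W).card * (1 + 2 * ε) ^ u) := by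
        have h1 := mul_le_mul_of_nonneg_right hxW (show 0 ≤ (1 + 2 * ε) ^ u by positivity)
        rw [pow_succ] at hW
        linarith
      cases i
      · obtain ⟨b, rfl⟩ : ∃ b', b = b' + 1 := ⟨b - 1, by omega⟩
        rw [← add_assoc, pow_succ] at hgain
        rcases ih a b (colorNbrs H false x W) (by omega) (by omega) ha (by omega)
          (by linarith) with ⟨T, hT, h⟩ | ⟨T, hT, h⟩
        · exact Or.inl ⟨T, hT.trans colorNbrs_subset, h⟩
        · exact Or.inr (Forces.insert_clique hx hT h)
      · obtain ⟨a, rfl⟩ : ∃ a', a = a' + 1 := ⟨a - 1, by omega⟩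
        rw [add_right_comm, pow_succ] at hgain
        rcases ih a b (colorNbrs H true x W) (by omega) (by omega) (by omega) hb
          (by linarith) with ⟨T, hT, h⟩ | ⟨T, hT, h⟩
        · exact Or.inl (Forces.insert_clique hx hT h)
        · exact Or.inr ⟨T, hT.trans colorNbrs_subset, h⟩
    · push Not at hheavy
      have hWlow : (2 : ℝ) ^ (a + b) * Real.exp (-(t / 10 ^ 18)) ≤ W.card := by
        have h1 : (1 + 2 * ε) ^ (u + 1) ≤ Real.exp (t / 10 ^ 18) := by
          have h2 := pow_le_pow_left₀ (by positivity) (Real.add_one_le_exp (2 * ε)) (u + 1)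
          rw [← Real.exp_nat_mul] at h2
          have h3 : 4 * (u + 1) ≤ t := by omega
          have h4 : 4 * ((u + 1 : ℕ) : ℝ) ≤ t := by exact_mod_cast h3
          rw [add_comm 1 (2 * ε)]
          refine h2.trans (Real.exp_le_exp.mpr ?_)
          rw [hε]
          linarith
        rw [Real.exp_neg, ← div_eq_mul_inv, div_le_iff₀ (Real.exp_pos _)]
        exact hW.trans (mul_le_mul_of_nonneg_left h1 (Nat.cast_nonneg _))
      have hkt1 : (10 ^ 15 * t : ℝ) ≤ k := by exact_mod_cast hkt
      have hkt2 : (k : ℝ) ≤ 2 * 10 ^ 15 * t := by exact_mod_cast hkt'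
      have hX : Real.exp (7 * 10 ^ 10 * t) ≤ W.card := by
        refine le_trans ?_ hWlow
        have h1 : Real.exp (k * Real.log 2) ≤ (2 : ℝ) ^ (a + b) := by
          rw [Real.exp_nat_mul, Real.exp_log (by norm_num)]
          exact pow_le_pow_right₀ (by norm_num) (by omega)
        refine le_trans ?_ (mul_le_mul_of_nonneg_right h1 (Real.exp_pos _).le)
        rw [← Real.exp_add]
        refine Real.exp_le_exp.mpr ?_
        have h2 := mul_le_mul_of_nonneg_left Real.log_two_gt_d9.le (Nat.cast_nonneg (α := ℝ) k)
        linarith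
      have hεW : 1 ≤ ε * W.card := by
        have h1 := Real.add_one_le_exp (7 * 10 ^ 10 * (t : ℝ))
        rw [hε, one_div, ← div_eq_inv_mul, le_div_iff₀ (by norm_num)]
        linarith
      have hdeg : ∀ i, ∀ x ∈ W, (1 / 2 - 2 * ε) * W.card ≤ (colorNbrs H i x W).card := by
        intro i x hx
        have h1 : (W.card : ℝ) ≤ (colorNbrs H true x W).card + (colorNbrs H false x W).card + 1 := by
          exact_mod_cast card_le_colorNbrs_add hH x W
        have h2 := hheavy (!i) x hx
        cases i <;> simp only [Bool.not_true, Bool.not_false] at h2 <;> linarith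
      -- Of the saving `62`, the book uses `55` and the size deficit of `W` uses `1`, in units of `t
      -- / 10 ^ 18`.
      set m : ℝ := 2 ^ (a + b) * Real.exp (-(t * (Real.log 2 + 62 / 10 ^ 18))) with hm
      obtain ⟨i, T, hT, S, hS, hTc, hSm, hTS⟩ := exists_book hH ht (W := W) (m := m)
        (by positivity) (by rw [← hε]; exact hdeg) hX (by
          have e : Real.exp (t * (Real.log 2 + 55 / 10 ^ 18)) * m =
              2 ^ (a + b) * Real.exp (t * (Real.log 2 + 55 / 10 ^ 18) +
                -(t * (Real.log 2 + 62 / 10 ^ 18))) := by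
            rw [hm, Real.exp_add]; ring
          rw [e]
          refine le_trans (mul_le_mul_of_nonneg_left (Real.exp_le_exp.mpr ?_)
            (by positivity)) hWlow
          linarith)
      cases i
      · have hc := choose_add_sub_le (a := b) (b := a) ht0 hkt2 (by omega) hb ha (by omega)
        rw [add_comm b a] at hc
        have hc' : (b - t + a).choose (b - t) ≤ S.card := by exact_mod_cast hc.trans hSm
        rcases (Forces.choose_of_pos (by omega) (by omega)).symm V H hH S hc' with
          ⟨T', hT', h⟩ | ⟨T', hT', h⟩
        · exact Or.inl ⟨T', hT'.trans hS, h⟩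
        · refine Or.inr ⟨T ∪ T', Finset.union_subset hT (hT'.trans hS), ?_⟩
          have := isNClique_union hTc h fun u hu v hv => hTS u hu v (hT' hv)
          rwa [show t + (b - t) = b by omega] at this
      · have hc := choose_add_sub_le (a := a) (b := b) ht0 hkt2 (by omega) ha hb (by omega)
        have hc' : (a - t + b).choose (a - t) ≤ S.card := by exact_mod_cast hc.trans hSm
        rcases (Forces.choose_of_pos (by omega) (by omega)) V H hH S hc' with
          ⟨T', hT', h⟩ | ⟨T', hT', h⟩
        · refine Or.inl ⟨T ∪ T', Finset.union_subset hT (hT'.trans hS), ?_⟩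
          have := isNClique_union hTc h fun u hu v hv => hTS u hu v (hT' hv)
          rwa [show t + (a - t) = a by omega] at this
        · exact Or.inr ⟨T', hT'.trans hS, h⟩

/-- The exponential improvement of the Erdős–Szekeres bound for diagonal Ramsey numbers. -/
theorem exists_forces_of_four_pow_mul_exp_le :
    ∃ η : ℝ, 0 < η ∧ η ≤ 1 ∧ ∃ K : ℕ, ∀ k ≥ K, ∀ n : ℕ,
      (4 : ℝ) ^ k * Real.exp (-(η * k)) ≤ n → Forces k k n := by
  -- With `t` about `k / 10 ^ 15`, `t / 4` gains of `1 + 2ε` give at least `exp (k / 10 ^ 35)`; `10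
  -- ^ 53` ensures `t ≥ 10 ^ 38`.
  refine ⟨1 / 10 ^ 35, by positivity, by norm_num, 10 ^ 53, fun k hk n hn V H hH W hW => ?_⟩
  set t := k / 10 ^ 15 with ht
  have hmod := Nat.div_add_mod k (10 ^ 15)
  have hlt := Nat.mod_lt k (show 0 < 10 ^ 15 by norm_num)
  rw [← ht] at hmod
  have ht38 : 10 ^ 38 ≤ t := by
    rw [ht, Nat.le_div_iff_mul_le (by norm_num)]
    exact le_trans (by norm_num) hk
  have ht38' : (10 ^ 38 : ℝ) ≤ t := by exact_mod_cast ht38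
  refine exists_clique_of_density hH (k := k) (t := t) (by linarith) (by omega) (by omega)
    (t / 4) k k W le_rfl le_rfl le_rfl le_rfl ?_
  have h1 : (4 : ℝ) ^ k * Real.exp (-(1 / 10 ^ 35 * k)) ≤ W.card :=
    hn.trans (by exact_mod_cast hW)
  have h2 : Real.exp (1 / 10 ^ 35 * k) ≤ (1 + 2 * (1 / (5 * 10 ^ 17)) : ℝ) ^ (t / 4) := by
    rw [← Real.exp_log (show (0 : ℝ) < (1 + 2 * (1 / (5 * 10 ^ 17)) : ℝ) ^ (t / 4) by positivity),
      Real.log_pow]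
    refine Real.exp_le_exp.mpr ?_
    have h3 := half_le_log_one_add (show (0 : ℝ) ≤ 2 * (1 / (5 * 10 ^ 17)) by positivity)
    rw [min_eq_left (by norm_num)] at h3
    have h4 : k ≤ 16 * 10 ^ 15 * (t / 4) := by omega
    have h5 : (k : ℝ) ≤ 16 * 10 ^ 15 * ((t / 4 : ℕ) : ℝ) := by exact_mod_cast h4
    have h6 := mul_le_mul_of_nonneg_left h3 (Nat.cast_nonneg (α := ℝ) (t / 4))
    linarith
  have e : (2 : ℝ) ^ (k + k) = 4 ^ k * Real.exp (-(1 / 10 ^ 35 * k)) * Real.exp (1 / 10 ^ 35 * k) := by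
    rw [mul_assoc, ← Real.exp_add, neg_add_cancel, Real.exp_zero, mul_one, ← two_mul, pow_mul]
    norm_num
  rw [e]
  exact mul_le_mul h1 h2 (Real.exp_pos _).le (Nat.cast_nonneg _)

/-! ### Large `k`, small `k`, and the conclusion. -/

theorem eventually_ramseyNumber_le :
    ∀ᶠ k : ℕ in Filter.atTop, (ramseyNumber (k + 1) (k + 1) : ℝ) ≤
      Real.exp (-(Real.log (k : ℝ)) ^ 2) * ((2 * k).choose k : ℝ) := by
  obtain ⟨η, hη, hη1, K, hK⟩ := exists_forces_of_four_pow_mul_exp_le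
  have hlog : ∀ᶠ k : ℕ in Filter.atTop, (Real.log (k : ℝ)) ^ 2 ≤ η / 2 * k := by
    have h := (Real.isLittleO_pow_log_id_atTop (n := 2)).bound (show 0 < η / 2 by positivity)
    filter_upwards [tendsto_natCast_atTop_atTop.eventually h] with k hk
    simpa [abs_of_nonneg] using hk
  have hexp : ∀ᶠ k : ℕ in Filter.atTop, 10 * (k : ℝ) ≤ Real.exp (η / 2 * k) := by
    have h := (isLittleO_pow_exp_pos_mul_atTop 1 (show 0 < η / 2 by positivity)).bound
      (show (0 : ℝ) < 1 / 10 by norm_num)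
    filter_upwards [tendsto_natCast_atTop_atTop.eventually h] with k hk
    simp only [pow_one, Real.norm_eq_abs, Nat.abs_cast, Real.abs_exp] at hk
    linarith
  filter_upwards [hlog, hexp, Filter.eventually_ge_atTop K, Filter.eventually_gt_atTop 0]
    with k h1 h2 h3 h4
  have hA : 1 ≤ (4 : ℝ) ^ k * Real.exp (-(η * k)) := by
    have h5 : Real.exp (η * k) ≤ 4 ^ k := by
      have h6 : Real.exp 1 ≤ 4 := by linarith [Real.exp_one_lt_d9]
      have h7 := pow_le_pow_left₀ (Real.exp_pos 1).le h6 k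
      rw [← Real.exp_nat_mul, mul_one] at h7
      refine le_trans (Real.exp_le_exp.mpr ?_) h7
      exact mul_le_of_le_one_left (Nat.cast_nonneg _) hη1
    rw [Real.exp_neg, ← div_eq_mul_inv, le_div_iff₀ (Real.exp_pos _)]
    linarith
  set n := ⌈(4 : ℝ) ^ (k + 1) * Real.exp (-(η * ((k + 1 : ℕ) : ℝ)))⌉₊ with hn
  have hpos : (0 : ℝ) < (4 : ℝ) ^ (k + 1) * Real.exp (-(η * ((k + 1 : ℕ) : ℝ))) := by positivity
  have hR := (hK (k + 1) (by omega) n (Nat.le_ceil _)).ramseyNumber_le (Nat.ceil_pos.mpr hpos)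
  have hnle : (n : ℝ) ≤ 5 * (4 ^ k * Real.exp (-(η * k))) := by
    have h5 := Nat.ceil_lt_add_one hpos.le
    have h6 : Real.exp (-(η * ((k + 1 : ℕ) : ℝ))) ≤ Real.exp (-(η * k)) := by
      apply Real.exp_le_exp.mpr
      push_cast
      linarith
    have h7 := mul_le_mul_of_nonneg_left h6 (show (0 : ℝ) ≤ 4 ^ (k + 1) by positivity)
    have h8 : (4 : ℝ) ^ (k + 1) * Real.exp (-(η * k)) = 4 * (4 ^ k * Real.exp (-(η * k))) := by
      ring
    linarith
  have hC : (4 : ℝ) ^ k ≤ 2 * k * ((2 * k).choose k : ℝ) := by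
    have := Nat.four_pow_le_two_mul_self_mul_centralBinom k h4
    rw [Nat.centralBinom] at this
    exact_mod_cast this
  calc (ramseyNumber (k + 1) (k + 1) : ℝ) ≤ n := by exact_mod_cast hR
    _ ≤ 5 * (4 ^ k * Real.exp (-(η * k))) := hnle
    _ ≤ 5 * ((2 * k * ((2 * k).choose k : ℝ)) * Real.exp (-(η * k))) := by gcongr
    _ = (10 * k) * Real.exp (-(η * k)) * ((2 * k).choose k : ℝ) := by ring
    _ ≤ Real.exp (η / 2 * k) * Real.exp (-(η * k)) * ((2 * k).choose k : ℝ) := by gcongr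
    _ ≤ Real.exp (-(Real.log (k : ℝ)) ^ 2) * ((2 * k).choose k : ℝ) := by
        rw [← Real.exp_add]
        gcongr
        linarith

theorem ramseyNumber_le_choose_sub_one {k : ℕ} (hk : 3 ≤ k) :
    ramseyNumber (k + 1) (k + 1) ≤ (2 * k).choose k - 1 := by
  obtain ⟨r, rfl⟩ : ∃ r, k = r + 3 := ⟨k - 3, by omega⟩
  have h := Forces.choose_sub_one (r + 1) r
  rw [show r + 1 + 3 = r + 3 + 1 by ring, show r + 4 = r + 3 + 1 by ring,
    show r + 1 + r + 5 = 2 * (r + 3) by ring, show r + 1 + 2 = r + 3 by ring] at h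
  refine h.ramseyNumber_le ?_
  have h1 : (2 * (r + 3)).choose 1 ≤ (2 * (r + 3)).choose (r + 3) := by
    have := Nat.choose_le_centralBinom 1 (r + 3)
    rwa [Nat.centralBinom] at this
  rw [Nat.choose_one_right] at h1
  omega

theorem theorem1 :
    ∃ c : ℝ, 0 < c ∧ ∀ k : ℕ, 3 ≤ k →
      (ramseyNumber (k + 1) (k + 1) : ℝ) ≤
        Real.exp (-c * (Real.log (k : ℝ)) ^ 2) * ((2 * k).choose k : ℝ) := by
  obtain ⟨K, hK⟩ := Filter.eventually_atTop.mp eventually_ramseyNumber_le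
  have hD : (1 : ℝ) ≤ 4 ^ K * ((K : ℝ) + 1) ^ 2 := by
    have h1 : (1 : ℝ) ≤ 4 ^ K := one_le_pow₀ (by norm_num)
    have h2 : (1 : ℝ) ≤ ((K : ℝ) + 1) ^ 2 := one_le_pow₀ (by linarith [Nat.cast_nonneg (α := ℝ) K])
    nlinarith
  -- Chosen so that for `k < K` the exponent `c * (log k) ^ 2` is at most `1 / C`; then `C - 1 ≤ exp
  -- (-(1 / C)) * C` finishes.
  refine ⟨1 / (4 ^ K * ((K : ℝ) + 1) ^ 2), by positivity, fun k hk => ?_⟩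
  have hc1 : 1 / (4 ^ K * ((K : ℝ) + 1) ^ 2) ≤ 1 := by
    rw [div_le_one (by linarith)]; exact hD
  rcases le_or_gt K k with h | h
  · refine (hK k h).trans ?_
    gcongr
    have := mul_le_mul_of_nonneg_right hc1 (sq_nonneg (Real.log (k : ℝ)))
    linarith
  · set C : ℝ := ((2 * k).choose k : ℝ) with hC
    have hCpos : 0 < C := by
      rw [hC]; exact_mod_cast Nat.choose_pos (by omega)
    have hC4 : C ≤ 4 ^ K := by
      have h1 : (2 * k).choose k ≤ 4 ^ k := by
        have := Nat.choose_le_two_pow (2 * k) k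
        rwa [pow_mul] at this
      have h2 : 4 ^ k ≤ 4 ^ K := Nat.pow_le_pow_right (by norm_num) h.le
      rw [hC]; exact_mod_cast h1.trans h2
    have hR : (ramseyNumber (k + 1) (k + 1) : ℝ) ≤ C - 1 := by
      have h1 := ramseyNumber_le_choose_sub_one hk
      have h2 : 0 < (2 * k).choose k := Nat.choose_pos (by omega)
      have h3 : ramseyNumber (k + 1) (k + 1) + 1 ≤ (2 * k).choose k := by omega
      have h4 : (ramseyNumber (k + 1) (k + 1) : ℝ) + 1 ≤ C := by rw [hC]; exact_mod_cast h3
      linarith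
    have hlog : (Real.log (k : ℝ)) ^ 2 ≤ ((K : ℝ) + 1) ^ 2 := by
      have h1 : (1 : ℝ) ≤ k := by exact_mod_cast (by omega : 1 ≤ k)
      have h2 := Real.log_nonneg h1
      have h3 := Real.log_le_sub_one_of_pos (show (0 : ℝ) < k by linarith)
      have h4 : (k : ℝ) ≤ K := by exact_mod_cast h.le
      exact pow_le_pow_left₀ h2 (by linarith) 2
    have hexp : -(1 / C) ≤ -(1 / (4 ^ K * ((K : ℝ) + 1) ^ 2)) * (Real.log (k : ℝ)) ^ 2 := by
      rw [neg_mul, neg_le_neg_iff, one_div_mul_eq_div, div_le_div_iff₀ (by positivity) hCpos,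
        one_mul, mul_comm (4 ^ K : ℝ)]
      exact mul_le_mul hlog hC4 hCpos.le (by positivity)
    calc (ramseyNumber (k + 1) (k + 1) : ℝ) ≤ C - 1 := hR
      _ = (-(1 / C) + 1) * C := by field_simp; ring
      _ ≤ Real.exp (-(1 / C)) * C := by
          gcongr
          exact Real.add_one_le_exp _
      _ ≤ _ := by gcongr
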